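/- Let $r,c\in\mathbb{R}^n$ have nonnegative entries with $\|r\|_1=\|c\|_1=1$. Let $\mathcal{P}=\{P\in\mathbb{R}^{n\times n}: P\mathbf{1}=r,\ P^\top\mathbf{1}=c,\ P\ge 0\}$, let $\mathcal{V}$ be its set of vertices, and write $C\cdot P=\sum_{i,j}c_{ij}p_{ij}$ and $\|M\|_1=\sum_{i,j}|m_{ij}|$. For a cost matrix $C\in\mathbb{R}^{n\times n}$ let $\mathcal{O}=\arg\min_{P\in\mathcal{V}}C\cdot P$, $\mathcal{F}=\mathrm{Conv}(\mathcal{O})$ and, when $\mathcal{V}\setminus\mathcal{O}\neq\emptyset$, $\Delta=\min_{Q\in\mathcal{V}\setminus\mathcal{O}}C\cdot Q-\min_{P\in\mathcal{O}}C\cdot P$. For a matrix $M\in\mathbb{R}^{m\times k}$ let $\tau(M)$ be the number of its nonzero entries divided by $mk$; $M$ is $(\lambda,\epsilon)$-sparse if there is $\tilde M$ with $\tau(\tilde M)\le\lambda$ and $\|M-\tilde M\|_1\le\epsilon$. Put $\lambda^\star=\tau(\mathcal{F})=\max_{M\in\mathcal{F}}\tau(M)$ and $\mathrm{dist}(\mathcal{F},P)=\min_{M\in\mathcal{F}}\|M-P\|_1$.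 For $\eta>0$ and dual variables $x,y\in\mathbb{R}^n$ let $P(x,y)=\exp(\eta(-C+x\mathbf{1}^\top+\mathbf{1}y^\top)-1)$ (entrywise) and $$f(x,y)=-\tfrac1\eta\sum_{i,j}\exp(\eta(-c_{ij}+x_i+y_j)-1)+\sum_i r_ix_i+\sum_j c_jy_j .$$ If $r,c$ have positive entries, one Sinkhorn iteration replaces $x$ by $x+(\log r-\log(P(x,y)\mathbf{1}))/\eta$ and then, with the new $x$, replaces $y$ by $y+(\log c-\log(P(x,y)^\top\mathbf{1}))/\eta$. Let $(x_t,y_t)$ be the result of $t$ iterations from $(x_0,y_0)$ and $P_{t,\eta}=P(x_t,y_t)$. (1) Assume that $r,c$ have positive entries and $\mathcal{V}\setminus\mathcal{O}\ne\emptyset$. There is a constant $t_1$, depending only on $n,r,c,C$, such that for every $\eta>\frac{1+2\log n}{\Delta}$ there is a constant $q>0$, depending only on $n,r,c,C,\eta$, such that for all $x_0,y_0\in\mathbb{R}^n$ and all integers $t>t_1$, with $$\epsilon_{t,\eta}:=6n^2e^{-\eta\Delta}+\frac{\sqrt q}{\sqrt t},$$ one has $\mathrm{dist}(\mathcal{F},P_{t,\eta})\le\epsilon_{t,\eta}$;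 the matrix $P_{t,\eta}$ is $(\lambda^\star,\epsilon_{t,\eta})$-sparse; and the rescaled Hessian $\eta^{-1}\nabla^2f(x_t,y_t)\in\mathbb{R}^{2n\times 2n}$ is $\left(\frac{\lambda^\star}{2}+\frac1{2n},\,2\epsilon_{t,\eta}\right)$-sparse. (2) Let $\mathcal{S}\subset\mathbb{R}^{n\times n}$ be the set of cost matrices $C$ for which $\min_{P\in\mathcal{P}}C\cdot P$ has more than one minimizer. Then $\mathcal{S}$ has Lebesgue measure zero. For every $C\notin\mathcal{S}$ the minimizer exists and is unique, and $\lambda^\star\le 2/n$; if moreover $r=c=\frac1n\mathbf{1}$, then $\lambda^\star=1/n$. -/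

import Mathlib

namespace EntropicOT

open scoped Matrix

/-- The entrywise `ℓ¹` norm of a matrix. -/
def l1Norm {ι κ : Type*} [Fintype ι] [Fintype κ] (M : Matrix ι κ ℝ) : ℝ :=
  ∑ i, ∑ j, |M i j|

/-- The `ℓ⁰` norm of a matrix: the number of its nonzero entries. -/
noncomputable def l0Norm {ι κ : Type*} [Fintype ι] [Fintype κ] (M : Matrix ι κ ℝ) : ℕ :=
  (Finset.univ.filter fun p : ι × κ => M p.1 p.2 ≠ 0).card

/-- The sparsity `τ(M)`: the proportion of nonzero entries. -/
noncomputable def sparsity {ι κ : Type*} [Fintype ι] [Fintype κ] (M : Matrix ι κ ℝ) : ℝ :=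
  (l0Norm M : ℝ) / ((Fintype.card ι : ℝ) * (Fintype.card κ : ℝ))

/-- `M` is `(lam, eps)`-sparse: some matrix of sparsity at most `lam` is within entrywise
`ℓ¹` distance `eps` of `M`. -/
def IsApproxSparse {ι κ : Type*} [Fintype ι] [Fintype κ] (M : Matrix ι κ ℝ)
    (lam eps : ℝ) : Prop :=
  ∃ M' : Matrix ι κ ℝ, sparsity M' ≤ lam ∧ l1Norm (M - M') ≤ eps

/-- The transport cost `C · P = ∑ i j, c_ij p_ij`. -/
def cost {n : ℕ} (C P : Matrix (Fin n) (Fin n) ℝ) : ℝ :=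
  ∑ i, ∑ j, C i j * P i j

/-- The feasible polyhedron `{P | P 1 = r, Pᵀ 1 = c, P ≥ 0}`. -/
def transportPolytope {n : ℕ} (r c : Fin n → ℝ) : Set (Matrix (Fin n) (Fin n) ℝ) :=
  {P | P *ᵥ (fun _ => 1) = r ∧ Pᵀ *ᵥ (fun _ => 1) = c ∧ ∀ i j, 0 ≤ P i j}

/-- The vertices of the feasible polyhedron. -/
def vertices {n : ℕ} (r c : Fin n → ℝ) : Set (Matrix (Fin n) (Fin n) ℝ) :=
  (transportPolytope r c).extremePoints ℝ

/-- The vertices of minimal cost among all vertices. -/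
def optimalVertices {n : ℕ} (C : Matrix (Fin n) (Fin n) ℝ) (r c : Fin n → ℝ) :
    Set (Matrix (Fin n) (Fin n) ℝ) :=
  {P | P ∈ vertices r c ∧ ∀ Q ∈ vertices r c, cost C P ≤ cost C Q}

/-- The vertex optimality gap `Δ`: the least cost of a non-optimal vertex minus the cost of an
optimal vertex. It is meaningful when some vertex is not optimal (the vertex set is finite, so
the infima are then minima). -/
noncomputable def vertexGap {n : ℕ} (C : Matrix (Fin n) (Fin n) ℝ) (r c : Fin n → ℝ) : ℝ :=
  sInf (cost C '' (vertices r c \ optimalVertices C r c)) -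
    sInf (cost C '' optimalVertices C r c)

/-- The optimal face `F`: the convex hull of the optimal vertices. -/
def optimalFace {n : ℕ} (C : Matrix (Fin n) (Fin n) ℝ) (r c : Fin n → ℝ) :
    Set (Matrix (Fin n) (Fin n) ℝ) :=
  convexHull ℝ (optimalVertices C r c)

/-- The sparsity `τ(F)` of the optimal face: the largest sparsity of one of its elements. -/
noncomputable def faceSparsity {n : ℕ} (C : Matrix (Fin n) (Fin n) ℝ) (r c : Fin n → ℝ) : ℝ :=
  sSup (sparsity '' optimalFace C r c)

/-- The entrywise `ℓ¹` distance from `P` to the optimal face. -/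
noncomputable def faceDist {n : ℕ} (C : Matrix (Fin n) (Fin n) ℝ) (r c : Fin n → ℝ)
    (P : Matrix (Fin n) (Fin n) ℝ) : ℝ :=
  sInf ((fun M => l1Norm (M - P)) '' optimalFace C r c)

/-- `P` solves the (unregularized) optimal transport problem. -/
def IsOptimalPlan {n : ℕ} (C : Matrix (Fin n) (Fin n) ℝ) (r c : Fin n → ℝ)
    (P : Matrix (Fin n) (Fin n) ℝ) : Prop :=
  P ∈ transportPolytope r c ∧ ∀ Q ∈ transportPolytope r c, cost C P ≤ cost C Q

/-- The set `S` of cost matrices for which optimal transport has more than one solution. -/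
def nonUniqueCosts {n : ℕ} (r c : Fin n → ℝ) : Set (Matrix (Fin n) (Fin n) ℝ) :=
  {C | ∃ P Q, IsOptimalPlan C r c P ∧ IsOptimalPlan C r c Q ∧ P ≠ Q}

/-- The matrix `exp (η (-C + x 1ᵀ + 1 yᵀ) - 1)` (entrywise) formed from dual variables. -/
noncomputable def plan {n : ℕ} (η : ℝ) (C : Matrix (Fin n) (Fin n) ℝ) (x y : Fin n → ℝ) :
    Matrix (Fin n) (Fin n) ℝ :=
  Matrix.of fun i j => Real.exp (η * (-C i j + x i + y j) - 1)

/-- The row scaling update of the dual variable `x`. -/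
noncomputable def rowUpdate {n : ℕ} (η : ℝ) (C : Matrix (Fin n) (Fin n) ℝ) (r : Fin n → ℝ)
    (x y : Fin n → ℝ) : Fin n → ℝ :=
  fun i => x i + (Real.log (r i) - Real.log ((plan η C x y *ᵥ (fun _ => 1)) i)) / η

/-- The column scaling update of the dual variable `y`. -/
noncomputable def colUpdate {n : ℕ} (η : ℝ) (C : Matrix (Fin n) (Fin n) ℝ) (c : Fin n → ℝ)
    (x y : Fin n → ℝ) : Fin n → ℝ :=
  fun j => y j + (Real.log (c j) - Real.log (((plan η C x y)ᵀ *ᵥ (fun _ => 1)) j)) / η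

/-- One Sinkhorn iteration: a row scaling followed by a column scaling. -/
noncomputable def sinkhornStep {n : ℕ} (η : ℝ) (C : Matrix (Fin n) (Fin n) ℝ)
    (r c : Fin n → ℝ) (z : (Fin n → ℝ) × (Fin n → ℝ)) : (Fin n → ℝ) × (Fin n → ℝ) :=
  (rowUpdate η C r z.1 z.2, colUpdate η C c (rowUpdate η C r z.1 z.2) z.2)

/-- The dual variables after `t` Sinkhorn iterations started at `(x₀, y₀)`. -/
noncomputable def sinkhornDual {n : ℕ} (η : ℝ) (C : Matrix (Fin n) (Fin n) ℝ)
    (r c : Fin n → ℝ) (x₀ y₀ : Fin n → ℝ) (t : ℕ) : (Fin n → ℝ) × (Fin n → ℝ) :=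
  (sinkhornStep η C r c)^[t] (x₀, y₀)

/-- The Sinkhorn iterate `P_{t,η}`. -/
noncomputable def sinkhornPlan {n : ℕ} (η : ℝ) (C : Matrix (Fin n) (Fin n) ℝ)
    (r c : Fin n → ℝ) (x₀ y₀ : Fin n → ℝ) (t : ℕ) : Matrix (Fin n) (Fin n) ℝ :=
  plan η C (sinkhornDual η C r c x₀ y₀ t).1 (sinkhornDual η C r c x₀ y₀ t).2

/-- The Lyapunov potential
`f(x,y) = -(1/η) ∑ i j, exp (η (-c_ij + x_i + y_j) - 1) + ∑ i, r_i x_i + ∑ j, c_j y_j`,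
as a function of the joint variable with blocks `x` (left) and `y` (right). -/
noncomputable def lyapunov {n : ℕ} (η : ℝ) (C : Matrix (Fin n) (Fin n) ℝ)
    (r c : Fin n → ℝ) (z : Fin n ⊕ Fin n → ℝ) : ℝ :=
  -(1 / η) * (∑ i, ∑ j, Real.exp (η * (-C i j + z (Sum.inl i) + z (Sum.inr j)) - 1))
    + ∑ i, r i * z (Sum.inl i) + ∑ j, c j * z (Sum.inr j)

/-- The Hessian matrix of second partial derivatives of `f` at `z`. -/
noncomputable def hessian {ι : Type*} [Fintype ι] [DecidableEq ι] (f : (ι → ℝ) → ℝ)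
    (z : ι → ℝ) : Matrix ι ι ℝ :=
  Matrix.of fun a b =>
    fderiv ℝ (fun w => fderiv ℝ f w (Pi.single b 1)) z (Pi.single a 1)

/-- The Hessian of the Lyapunov potential after `t` Sinkhorn iterations. -/
noncomputable def sinkhornHessian {n : ℕ} (η : ℝ) (C : Matrix (Fin n) (Fin n) ℝ)
    (r c : Fin n → ℝ) (x₀ y₀ : Fin n → ℝ) (t : ℕ) : Matrix (Fin n ⊕ Fin n) (Fin n ⊕ Fin n) ℝ :=
  hessian (lyapunov η C r c)
    (Sum.elim (sinkhornDual η C r c x₀ y₀ t).1 (sinkhornDual η C r c x₀ y₀ t).2)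

/-- The error `ε_{t,η} = 6 n² exp (-η Δ) + √q / √t`. -/
noncomputable def errorBound {n : ℕ} (η : ℝ) (C : Matrix (Fin n) (Fin n) ℝ)
    (r c : Fin n → ℝ) (q : ℝ) (t : ℕ) : ℝ :=
  6 * (n : ℝ) ^ 2 * Real.exp (-η * vertexGap C r c) + Real.sqrt q / Real.sqrt (t : ℝ)

end EntropicOT

namespace EntropicOT

open scoped Matrix Topology
open Filter

/-! For part (1), the Sinkhorn iterate is compared with the optimal face through the entropically
regularized plan, the feasible matrix of exponential form. That plan is `(1 - a) • A + a • B` with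
`A` on the face and `B` a mixture of suboptimal vertices. Replacing it by `A` saves at least `a * Δ`
in cost, while entropies lie in `[0, 2 log n]`; regularized optimality therefore forces `a ≤ e n²
exp (-η Δ)` (`exists_mem_optimalFace_l1Norm_le`).

Sinkhorn is alternating maximization of a concave dual. The relative entropy of the regularized plan
to an iterate is `η` times the dual gap. One iteration lowers it by at least a quarter of the
squared row error, and it is at most a constant times the row error. Hence it decays like `1/t`, and
a Pinsker inequality gives `1/√t` in `ℓ¹` (`l1Norm_plan_sub_sinkhornPlan_le`). Row scaling bounds
the oscillation of the row potential independently of the start, so the constant is uniform. The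
Hessian consists of two diagonal blocks and two copies of the plan up to sign, so sparsity transfers
to it (`isApproxSparse_hessian`).

For part (2), vertices are determined by their supports, hence finite in number. Non-uniqueness puts
`C` on one of finitely many hyperplanes on which two vertices have equal cost. Otherwise the face is
one vertex, with at most `2n` nonzero entries, or a scaled permutation matrix when the marginals are
uniform. -/

/-! ### The transport polytope and its vertices. -/

lemma mem_transportPolytope {n : ℕ} {r c : Fin n → ℝ} {P : Matrix (Fin n) (Fin n) ℝ} :
    P ∈ transportPolytope r c ↔
      (∀ i, ∑ j, P i j = r i) ∧ (∀ j, ∑ i, P i j = c j) ∧ ∀ i j, 0 ≤ P i j := by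
  simp [transportPolytope, funext_iff, Matrix.mulVec, dotProduct]

lemma convex_transportPolytope {n : ℕ} (r c : Fin n → ℝ) : Convex ℝ (transportPolytope r c) := by
  intro P hP Q hQ a b ha hb hab
  rw [mem_transportPolytope] at *
  refine ⟨fun i => ?_, fun j => ?_, fun i j => ?_⟩
  · simp [Finset.sum_add_distrib, ← Finset.mul_sum, hP.1, hQ.1, ← add_mul, hab]
  · simp [Finset.sum_add_distrib, ← Finset.mul_sum, hP.2.1, hQ.2.1, ← add_mul, hab]
  · have := hP.2.2 i j
    have := hQ.2.2 i j
    simp only [Matrix.add_apply, Matrix.smul_apply, smul_eq_mul]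
    positivity

lemma le_of_mem_transportPolytope {n : ℕ} {r c : Fin n → ℝ} {P : Matrix (Fin n) (Fin n) ℝ}
    (hP : P ∈ transportPolytope r c) (i j : Fin n) : P i j ≤ r i := by
  rw [mem_transportPolytope] at hP
  rw [← hP.1 i]
  exact Finset.single_le_sum (fun k _ => hP.2.2 i k) (Finset.mem_univ j)

lemma isCompact_transportPolytope {n : ℕ} (r c : Fin n → ℝ) :
    IsCompact (transportPolytope r c : Set (Fin n → Fin n → ℝ)) := by
  have hK : IsCompact (Set.univ.pi fun i : Fin n => Set.univ.pi fun _ : Fin n =>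
      Set.Icc (0 : ℝ) (r i)) :=
    isCompact_univ_pi fun i => isCompact_univ_pi fun j => isCompact_Icc
  refine hK.of_isClosed_subset ?_ ?_
  · have : (transportPolytope r c : Set (Fin n → Fin n → ℝ)) =
        (⋂ i, {P | ∑ j, P i j = r i}) ∩ ((⋂ j, {P | ∑ i, P i j = c j}) ∩
          ⋂ i, ⋂ j, {P | 0 ≤ P i j}) := by
      ext P
      simp only [Set.mem_inter_iff, Set.mem_iInter, Set.mem_ofPred_eq]
      exact mem_transportPolytope
    rw [this]
    refine (isClosed_iInter fun i => isClosed_eq (by fun_prop) (by fun_prop)).inter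
      ((isClosed_iInter fun i => isClosed_eq (by fun_prop) (by fun_prop)).inter
        (isClosed_iInter fun i => isClosed_iInter fun j =>
          isClosed_le (by fun_prop) (by fun_prop)))
  · intro P hP i _ j _
    exact ⟨(mem_transportPolytope.1 hP).2.2 i j, le_of_mem_transportPolytope hP i j⟩

/-- The product coupling `r cᵀ` is feasible. -/
lemma vecMulVec_mem_transportPolytope {n : ℕ} {r c : Fin n → ℝ}
    (hr : ∀ i, 0 ≤ r i) (hc : ∀ j, 0 ≤ c j) (hr1 : ∑ i, r i = 1) (hc1 : ∑ j, c j = 1) :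
    Matrix.vecMulVec r c ∈ transportPolytope r c := by
  rw [mem_transportPolytope]
  refine ⟨fun i => ?_, fun j => ?_, fun i j => mul_nonneg (hr i) (hc j)⟩
  · simp [Matrix.vecMulVec_apply, ← Finset.mul_sum, hc1]
  · simp [Matrix.vecMulVec_apply, ← Finset.sum_mul, hr1]

lemma sum_of_mem_transportPolytope {n : ℕ} {r c : Fin n → ℝ} {P : Matrix (Fin n) (Fin n) ℝ}
    (hr1 : ∑ i, r i = 1) (hP : P ∈ transportPolytope r c) : ∑ i, ∑ j, P i j = 1 := by
  simp [(mem_transportPolytope.1 hP).1, hr1]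

/-- A perturbation of a vertex that preserves the marginals and the support vanishes. -/
lemma eq_zero_of_mem_vertices {n : ℕ} {r c : Fin n → ℝ} {P D : Matrix (Fin n) (Fin n) ℝ}
    (hP : P ∈ vertices r c) (hrow : ∀ i, ∑ j, D i j = 0) (hcol : ∀ j, ∑ i, D i j = 0)
    (hsupp : ∀ i j, P i j = 0 → D i j = 0) : D = 0 := by
  obtain ⟨hPt, hext⟩ := mem_extremePoints.1 hP
  have hPt' := mem_transportPolytope.1 hPt
  -- For small `ε` both `P + ε • D` and `P - ε • D` stay nonnegative, and `P` is their midpoint.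
  have key : ∀ᶠ ε in 𝓝[>] (0 : ℝ), ∀ i j, ε * |D i j| ≤ P i j := by
    refine eventually_all.2 fun i => eventually_all.2 fun j => ?_
    rcases eq_or_lt_of_le (hPt'.2.2 i j) with h | h
    · simp [← h, hsupp i j h.symm]
    · have : Tendsto (fun ε : ℝ => ε * |D i j|) (𝓝[>] 0) (𝓝 0) := by
        have : Continuous fun ε : ℝ => ε * |D i j| := by fun_prop
        simpa using (this.tendsto 0).mono_left nhdsWithin_le_nhds
      exact (this.eventually_lt_const h).mono fun _ => le_of_lt
  obtain ⟨ε, hε, hεpos⟩ := (key.and self_mem_nhdsWithin).exists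
  have hεpos : 0 < ε := hεpos
  have hmem : ∀ s : ℝ, |s| = ε → P + s • D ∈ transportPolytope r c := by
    intro s hs
    rw [mem_transportPolytope]
    refine ⟨fun i => ?_, fun j => ?_, fun i j => ?_⟩
    · simp [Finset.sum_add_distrib, ← Finset.mul_sum, hPt'.1, hrow]
    · simp [Finset.sum_add_distrib, ← Finset.mul_sum, hPt'.2.1, hcol]
    · have h1 := hε i j
      rw [← hs, ← abs_mul] at h1
      simpa using by linarith [neg_abs_le (s * D i j)]
  have h := (hext _ (hmem ε (abs_of_pos hεpos)) _ (hmem (-ε) (by simp [abs_of_pos hεpos]))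
    ⟨1 / 2, 1 / 2, by norm_num, by norm_num, by norm_num, by module⟩).1
  simpa [hεpos.ne'] using h

/-- The support determines a vertex: the difference of two vertices with equal support has zero
marginals and lives on that support, so it vanishes. -/
lemma finite_vertices {n : ℕ} (r c : Fin n → ℝ) : (vertices r c).Finite := by
  refine Set.Finite.of_finite_image
    (f := fun P : Matrix (Fin n) (Fin n) ℝ => {p : Fin n × Fin n | P p.1 p.2 ≠ 0})
    (Set.toFinite _) ?_
  intro P hP Q hQ hPQ
  have hP' := mem_transportPolytope.1 hP.1
  have hQ' := mem_transportPolytope.1 hQ.1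
  refine sub_eq_zero.1 (eq_zero_of_mem_vertices (D := P - Q) hP ?_ ?_ ?_)
  · simp [hP'.1, hQ'.1]
  · simp [hP'.2.1, hQ'.2.1]
  · intro i j hij
    have : ((i, j) ∈ {p : Fin n × Fin n | P p.1 p.2 ≠ 0}) ↔
      (i, j) ∈ {p : Fin n × Fin n | Q p.1 p.2 ≠ 0} := by
      simp only at hPQ
      rw [hPQ]
    simp only [Set.mem_ofPred_eq, ne_eq, not_iff_not] at this
    simp [hij, this.1 hij]

/-- Krein–Milman, where finiteness of the vertex set makes the closure superfluous. -/
lemma convexHull_vertices {n : ℕ} (r c : Fin n → ℝ) :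
    convexHull ℝ (vertices r c) = transportPolytope r c := by
  have h := closure_convexHull_extremePoints (E := Fin n → Fin n → ℝ)
    (isCompact_transportPolytope r c) (convex_transportPolytope r c)
  have h2 : IsClosed (convexHull ℝ (vertices r c) : Set (Fin n → Fin n → ℝ)) :=
    ((finite_vertices r c).isCompact_convexHull (𝕜 := ℝ) (E := Fin n → Fin n → ℝ)).isClosed
  exact h2.closure_eq.symm.trans h

lemma nonempty_vertices {n : ℕ} {r c : Fin n → ℝ} (h : (transportPolytope r c).Nonempty) :
    (vertices r c).Nonempty := by
  rwa [← convexHull_vertices, convexHull_nonempty_iff] at h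

/-- A vertex has at most `2n` nonzero entries. -/
lemma l0Norm_le_of_mem_vertices {n : ℕ} {r c : Fin n → ℝ} {P : Matrix (Fin n) (Fin n) ℝ}
    (hP : P ∈ vertices r c) : l0Norm P ≤ 2 * n := by
  classical
  set S := Finset.univ.filter fun p : Fin n × Fin n => P p.1 p.2 ≠ 0 with hS
  let ext : (S → ℝ) → Matrix (Fin n) (Fin n) ℝ :=
    fun v => Matrix.of fun i j => if h : (i, j) ∈ S then v ⟨(i, j), h⟩ else 0
  -- The marginal map on matrices supported in `S`; its injectivity bounds `S.card` by the target
  -- dimension `2n`.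
  let L : (S → ℝ) →ₗ[ℝ] (Fin n → ℝ) × (Fin n → ℝ) :=
    { toFun := fun v => (fun i => ∑ j, ext v i j, fun j => ∑ i, ext v i j)
      map_add' := fun v w => by
        ext k <;> simp only [ext, Matrix.of_apply, Prod.mk_add_mk, Pi.add_apply,
          ← Finset.sum_add_distrib] <;>
        · refine Finset.sum_congr rfl fun l _ => ?_
          split_ifs <;> simp
      map_smul' := fun a v => by
        ext k <;> simp only [ext, Matrix.of_apply, Prod.smul_mk, Pi.smul_apply, smul_eq_mul,
          Finset.mul_sum, RingHom.id_apply] <;>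
        · refine Finset.sum_congr rfl fun l _ => ?_
          split_ifs <;> simp }
  have hinj : Function.Injective L := by
    rw [injective_iff_map_eq_zero]
    intro v hv
    have h0 : ext v = 0 := by
      refine eq_zero_of_mem_vertices hP (fun i => congrFun (congrArg Prod.fst hv) i)
        (fun j => congrFun (congrArg Prod.snd hv) j) fun i j hij => ?_
      simp [ext, hS, hij]
    ext ⟨⟨i, j⟩, h⟩
    have := congrFun (congrFun h0 i) j
    simpa [ext, h] using this
  have := LinearMap.finrank_le_finrank_of_injective hinj
  simp only [Module.finrank_fintype_fun_eq_card, Module.finrank_prod, Fintype.card_fin,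
    Fintype.card_coe] at this
  calc l0Norm P = S.card := rfl
    _ ≤ 2 * n := by omega

/-- The transport cost as a linear functional of the plan. -/
noncomputable def costLinear {n : ℕ} (C : Matrix (Fin n) (Fin n) ℝ) :
    Matrix (Fin n) (Fin n) ℝ →ₗ[ℝ] ℝ where
  toFun := cost C
  map_add' P Q := by simp [cost, mul_add, Finset.sum_add_distrib]
  map_smul' a P := by
    simp only [cost, Matrix.smul_apply, smul_eq_mul, RingHom.id_apply, Finset.mul_sum]
    exact Finset.sum_congr rfl fun i _ => Finset.sum_congr rfl fun j _ => by ring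

@[simp] lemma costLinear_apply {n : ℕ} (C P : Matrix (Fin n) (Fin n) ℝ) :
    costLinear C P = cost C P := rfl

lemma cost_combo {n : ℕ} (C P Q : Matrix (Fin n) (Fin n) ℝ) (a b : ℝ) :
    cost C (a • P + b • Q) = a * cost C P + b * cost C Q := by
  simp [← costLinear_apply]

lemma le_cost_of_mem_convexHull {n : ℕ} {C P : Matrix (Fin n) (Fin n) ℝ}
    {S : Set (Matrix (Fin n) (Fin n) ℝ)} {m : ℝ} (hS : ∀ Q ∈ S, m ≤ cost C Q)
    (hP : P ∈ convexHull ℝ S) : m ≤ cost C P :=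
  convexHull_min (t := {Q | m ≤ costLinear C Q}) hS
    (convex_halfSpace_ge (costLinear C).isLinear m) hP

lemma cost_le_of_mem_convexHull {n : ℕ} {C P : Matrix (Fin n) (Fin n) ℝ}
    {S : Set (Matrix (Fin n) (Fin n) ℝ)} {m : ℝ} (hS : ∀ Q ∈ S, cost C Q ≤ m)
    (hP : P ∈ convexHull ℝ S) : cost C P ≤ m :=
  convexHull_min (t := {Q | costLinear C Q ≤ m}) hS
    (convex_halfSpace_le (costLinear C).isLinear m) hP

/-! ### The optimal face and the vertex gap. -/

section Polytope

variable {n : ℕ} {C : Matrix (Fin n) (Fin n) ℝ} {r c : Fin n → ℝ}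

lemma optimalVertices_subset : optimalVertices C r c ⊆ vertices r c := fun _ h => h.1

lemma nonempty_optimalVertices (h : (transportPolytope r c).Nonempty) :
    (optimalVertices C r c).Nonempty :=
  Set.exists_min_image _ (cost C) (finite_vertices r c) (nonempty_vertices h)

lemma optimalFace_subset : optimalFace C r c ⊆ transportPolytope r c := by
  rw [← convexHull_vertices]
  exact convexHull_mono optimalVertices_subset

lemma cost_le_cost_of_mem_optimalFace {P Q : Matrix (Fin n) (Fin n) ℝ}
    (hP : P ∈ optimalFace C r c) (hQ : Q ∈ transportPolytope r c) : cost C P ≤ cost C Q := by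
  rw [← convexHull_vertices] at hQ
  exact cost_le_of_mem_convexHull (fun V hV => le_cost_of_mem_convexHull hV.2 hQ) hP

lemma sInf_cost_optimalVertices {P : Matrix (Fin n) (Fin n) ℝ}
    (hP : P ∈ optimalFace C r c) : sInf (cost C '' optimalVertices C r c) = cost C P := by
  have hne : (optimalVertices C r c).Nonempty := convexHull_nonempty_iff.1 ⟨P, hP⟩
  have hall : ∀ V ∈ optimalVertices C r c, cost C V = cost C P := fun V hV =>
    le_antisymm
      (cost_le_cost_of_mem_optimalFace (subset_convexHull ℝ _ hV) (optimalFace_subset hP))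
      (cost_le_cost_of_mem_optimalFace hP hV.1.1)
  have : cost C '' optimalVertices C r c = {cost C P} := by
    ext s
    constructor
    · rintro ⟨V, hV, rfl⟩
      exact hall V hV
    · rintro rfl
      obtain ⟨V, hV⟩ := hne
      exact ⟨V, hV, hall V hV⟩
  rw [this, csInf_singleton]

lemma vertexGap_le {P Q : Matrix (Fin n) (Fin n) ℝ} (hP : P ∈ optimalFace C r c)
    (hQ : Q ∈ convexHull ℝ (vertices r c \ optimalVertices C r c)) :
    cost C P + vertexGap C r c ≤ cost C Q := by
  rw [vertexGap, sInf_cost_optimalVertices hP, add_sub_cancel]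
  refine le_cost_of_mem_convexHull (fun V hV => csInf_le ?_ ⟨V, hV, rfl⟩) hQ
  exact (((finite_vertices r c).subset Set.sdiff_subset).image _).bddBelow

lemma vertexGap_pos (hne : (vertices r c \ optimalVertices C r c).Nonempty) :
    0 < vertexGap C r c := by
  obtain ⟨V, hV, hVmin⟩ := Set.exists_min_image _ (cost C)
    ((finite_vertices r c).subset Set.sdiff_subset) hne
  obtain ⟨P, hP⟩ := nonempty_optimalVertices (C := C) (r := r) (c := c) ⟨V, hV.1.1⟩
  have h1 : sInf (cost C '' (vertices r c \ optimalVertices C r c)) = cost C V :=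
    IsLeast.csInf_eq ⟨⟨V, hV, rfl⟩, by rintro _ ⟨W, hW, rfl⟩; exact hVmin W hW⟩
  rw [vertexGap, h1, sInf_cost_optimalVertices (subset_convexHull ℝ _ hP), sub_pos]
  by_contra! hle
  exact hV.2 ⟨hV.1, fun Q hQ => hle.trans (hP.2 Q hQ)⟩

/-- Every feasible plan is a mixture of a plan of the optimal face and a mixture of suboptimal
vertices. -/
lemma exists_decomposition (hne : (vertices r c \ optimalVertices C r c).Nonempty)
    {P : Matrix (Fin n) (Fin n) ℝ} (hP : P ∈ transportPolytope r c) :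
    ∃ A ∈ optimalFace C r c, ∃ B ∈ convexHull ℝ (vertices r c \ optimalVertices C r c),
      ∃ a : ℝ, 0 ≤ a ∧ a ≤ 1 ∧ P = (1 - a) • A + a • B := by
  have hO : (optimalVertices C r c).Nonempty := nonempty_optimalVertices ⟨P, hP⟩
  rw [← convexHull_vertices, ← Set.union_sdiff_cancel (optimalVertices_subset (C := C)),
    convexHull_union hO hne, mem_convexJoin] at hP
  obtain ⟨A, hA, B, hB, s, t, hs, ht, hst, rfl⟩ := hP
  exact ⟨A, hA, B, hB, t, ht, by linarith, by rw [← hst, add_sub_cancel_right]⟩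

/-- The optimal plans are exactly the elements of the optimal face. -/
lemma isOptimalPlan_iff {P : Matrix (Fin n) (Fin n) ℝ} :
    IsOptimalPlan C r c P ↔ P ∈ optimalFace C r c := by
  refine ⟨fun ⟨hP, hmin⟩ => ?_, fun h =>
    ⟨optimalFace_subset h, fun Q hQ => cost_le_cost_of_mem_optimalFace h hQ⟩⟩
  by_cases hne : (vertices r c \ optimalVertices C r c).Nonempty
  · obtain ⟨A, hA, B, hB, a, ha0, ha1, rfl⟩ := exists_decomposition hne hP
    have h1 := hmin A (optimalFace_subset hA)
    rw [cost_combo] at h1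
    have h2 := vertexGap_le hA hB
    have h3 := vertexGap_pos hne
    -- A positive weight `a` on suboptimal vertices would cost at least `a * Δ` more than `A`.
    have : a = 0 := by
      by_contra h
      have : 0 < a := lt_of_le_of_ne ha0 (Ne.symm h)
      nlinarith
    simpa [this] using hA
  · rw [Set.not_nonempty_iff_eq_empty, Set.sdiff_eq_empty] at hne
    rw [optimalFace, optimalVertices_subset.antisymm hne, convexHull_vertices]
    exact hP

end Polytope

/-! ### The entrywise norm, sparsity, and the face extrema. -/

section L1

variable {ι κ : Type*} [Fintype ι] [Fintype κ]

lemma l1Norm_nonneg (M : Matrix ι κ ℝ) : 0 ≤ l1Norm M := by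
  unfold l1Norm; positivity

lemma l1Norm_add_le (M N : Matrix ι κ ℝ) : l1Norm (M + N) ≤ l1Norm M + l1Norm N := by
  simp only [l1Norm, ← Finset.sum_add_distrib]
  exact Finset.sum_le_sum fun i _ => Finset.sum_le_sum fun j _ => abs_add_le _ _

lemma l1Norm_sub_comm (M N : Matrix ι κ ℝ) : l1Norm (M - N) = l1Norm (N - M) := by
  simp [l1Norm, abs_sub_comm]

lemma l1Norm_smul (a : ℝ) (M : Matrix ι κ ℝ) : l1Norm (a • M) = |a| * l1Norm M := by
  simp [l1Norm, abs_mul, Finset.mul_sum]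

/-- Supplies the upper bound that the `sSup` in `faceSparsity` needs. -/
lemma sparsity_le_one (M : Matrix ι κ ℝ) : sparsity M ≤ 1 := by
  classical
  refine div_le_one_of_le₀ ?_ (by positivity)
  have h : l0Norm M ≤ Fintype.card (ι × κ) := Finset.card_le_univ _
  rw [Fintype.card_prod] at h
  exact_mod_cast h

end L1

section Face

variable {n : ℕ} {C : Matrix (Fin n) (Fin n) ℝ} {r c : Fin n → ℝ}

lemma faceDist_le {M P : Matrix (Fin n) (Fin n) ℝ} (hM : M ∈ optimalFace C r c) :
    faceDist C r c P ≤ l1Norm (M - P) :=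
  csInf_le ⟨0, by rintro _ ⟨M, -, rfl⟩; exact l1Norm_nonneg _⟩ ⟨M, hM, rfl⟩

lemma sparsity_le_faceSparsity {M : Matrix (Fin n) (Fin n) ℝ} (hM : M ∈ optimalFace C r c) :
    sparsity M ≤ faceSparsity C r c :=
  le_csSup ⟨1, by rintro _ ⟨M, -, rfl⟩; exact sparsity_le_one _⟩ ⟨M, hM, rfl⟩

end Face

/-! ### Relative entropy and a Pinsker inequality. -/

section RelEntropy

variable {ι : Type*} [Fintype ι]

/-- The relative entropy `∑ p log (p / q)` of nonnegative vectors. -/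
noncomputable def relEntropy (p q : ι → ℝ) : ℝ :=
  ∑ i, p i * (Real.log (p i) - Real.log (q i))

/-- This is `log u ≤ u - 1` at `u = √b / √a`, multiplied by `2a`. The terms `-a + b` cancel on
summing vectors of equal mass. -/
lemma sq_sqrt_sub_sqrt_le {a b : ℝ} (ha : 0 ≤ a) (hb : 0 < b) :
    (√a - √b) ^ 2 ≤ a * (Real.log a - Real.log b) - a + b := by
  rcases ha.eq_or_lt with rfl | ha
  · simp [Real.sq_sqrt hb.le]
  have hsa := Real.sqrt_pos.2 ha
  have hsb := Real.sqrt_pos.2 hb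
  have h := Real.log_le_sub_one_of_pos (div_pos hsb hsa)
  rw [Real.log_div hsb.ne' hsa.ne', Real.log_sqrt hb.le, Real.log_sqrt ha.le] at h
  have h2 : a * (√b / √a) = √a * √b := by
    field_simp
    rw [Real.sq_sqrt ha.le]
  have h3 := mul_le_mul_of_nonneg_left h ha.le
  nlinarith [Real.sq_sqrt ha.le, Real.sq_sqrt hb.le]

lemma sum_sq_sqrt_sub_sqrt_le {p q : ι → ℝ} (hp : ∀ i, 0 ≤ p i) (hq : ∀ i, 0 < q i)
    (h : ∑ i, p i = ∑ i, q i) : ∑ i, (√(p i) - √(q i)) ^ 2 ≤ relEntropy p q := by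
  refine (Finset.sum_le_sum fun i _ => sq_sqrt_sub_sqrt_le (hp i) (hq i)).trans_eq ?_
  simp [Finset.sum_add_distrib, h, relEntropy]

lemma relEntropy_nonneg {p q : ι → ℝ} (hp : ∀ i, 0 ≤ p i) (hq : ∀ i, 0 < q i)
    (h : ∑ i, p i = ∑ i, q i) : 0 ≤ relEntropy p q :=
  (Finset.sum_nonneg fun _ _ => sq_nonneg _).trans (sum_sq_sqrt_sub_sqrt_le hp hq h)

/-- A Pinsker type inequality. -/
lemma sq_sum_abs_sub_le {p q : ι → ℝ} (hp : ∀ i, 0 ≤ p i) (hq : ∀ i, 0 < q i)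
    (hp1 : ∑ i, p i = 1) (hq1 : ∑ i, q i = 1) :
    (∑ i, |p i - q i|) ^ 2 ≤ 4 * relEntropy p q := by
  -- Cauchy–Schwarz on this factorization; the constant 4 bounds the sum of the squares of the
  -- second factors.
  have h1 : ∀ i, |p i - q i| = |√(p i) - √(q i)| * (√(p i) + √(q i)) := fun i => by
    rw [← abs_of_nonneg (by positivity : 0 ≤ √(p i) + √(q i)), ← abs_mul]
    congr 1
    nlinarith [Real.sq_sqrt (hp i), Real.sq_sqrt (hq i).le]
  have h2 : ∑ i, (√(p i) + √(q i)) ^ 2 ≤ 4 := by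
    have : ∀ i ∈ Finset.univ, (√(p i) + √(q i)) ^ 2 ≤ 2 * p i + 2 * q i := fun i _ => by
      nlinarith [Real.sq_sqrt (hp i), Real.sq_sqrt (hq i).le, sq_nonneg (√(p i) - √(q i))]
    refine (Finset.sum_le_sum this).trans_eq ?_
    rw [Finset.sum_add_distrib, ← Finset.mul_sum, ← Finset.mul_sum, hp1, hq1]
    norm_num
  have h3 := sum_sq_sqrt_sub_sqrt_le hp hq (hp1.trans hq1.symm)
  have h4 := Finset.sum_mul_sq_le_sq_mul_sq Finset.univ (fun i => |√(p i) - √(q i)|)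
    (fun i => √(p i) + √(q i))
  simp only [← h1, sq_abs] at h4
  have h5 : 0 ≤ ∑ i, (√(p i) - √(q i)) ^ 2 := Finset.sum_nonneg fun _ _ => sq_nonneg _
  nlinarith

end RelEntropy

/-! ### The regularized plan and its distance to the optimal face. -/

section Plan

variable {n : ℕ} {C : Matrix (Fin n) (Fin n) ℝ} {r c x y : Fin n → ℝ} {η : ℝ}

lemma plan_pos (i j : Fin n) : 0 < plan η C x y i j := Real.exp_pos _

lemma log_plan (i j : Fin n) :
    Real.log (plan η C x y i j) = η * (-C i j + x i + y j) - 1 := Real.log_exp _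

lemma sum_mul_add {A : Matrix (Fin n) (Fin n) ℝ} (hA : A ∈ transportPolytope r c)
    (u v : Fin n → ℝ) :
    ∑ i, ∑ j, A i j * (u i + v j) = ∑ i, r i * u i + ∑ j, c j * v j := by
  have hA := mem_transportPolytope.1 hA
  simp only [mul_add, Finset.sum_add_distrib]
  rw [Finset.sum_comm (f := fun i j => A i j * v j)]
  simp only [← Finset.sum_mul, hA.1, hA.2.1]

/-- The potentials see a feasible matrix only through its marginals, so between feasible matrices
only the cost term varies. -/
lemma sum_mul_log_plan {A : Matrix (Fin n) (Fin n) ℝ} (hA : A ∈ transportPolytope r c) :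
    ∑ i, ∑ j, A i j * Real.log (plan η C x y i j) =
      -(η * cost C A) + (η * (∑ i, r i * x i + ∑ j, c j * y j) - ∑ i, r i) := by
  rw [← sum_mul_add hA]
  simp only [← (mem_transportPolytope.1 hA).1, cost, log_plan, Finset.mul_sum,
    ← Finset.sum_sub_distrib, ← Finset.sum_neg_distrib, ← Finset.sum_add_distrib]
  exact Finset.sum_congr rfl fun i _ => Finset.sum_congr rfl fun j _ => by ring

/-- The negative entropy `∑ p log p`. -/
noncomputable def negEntropy (P : Matrix (Fin n) (Fin n) ℝ) : ℝ :=
  ∑ i, ∑ j, P i j * Real.log (P i j)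

/-- A feasible plan of exponential form minimizes the entropy regularized cost. -/
lemma regularized_cost_le (hr1 : ∑ i, r i = 1) (hP : plan η C x y ∈ transportPolytope r c)
    {A : Matrix (Fin n) (Fin n) ℝ} (hA : A ∈ transportPolytope r c) :
    η * cost C (plan η C x y) + negEntropy (plan η C x y) ≤ η * cost C A + negEntropy A := by
  have h := relEntropy_nonneg (p := fun k : Fin n × Fin n => A k.1 k.2)
    (q := fun k => plan η C x y k.1 k.2) (fun k => (mem_transportPolytope.1 hA).2.2 _ _)
    (fun k => plan_pos _ _) (by
      rw [Fintype.sum_prod_type, Fintype.sum_prod_type, sum_of_mem_transportPolytope hr1 hA,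
        sum_of_mem_transportPolytope hr1 hP])
  rw [relEntropy, Fintype.sum_prod_type] at h
  simp only [mul_sub, Finset.sum_sub_distrib] at h
  rw [sum_mul_log_plan hA] at h
  have h2 := sum_mul_log_plan (η := η) (C := C) (x := x) (y := y) hP
  simp only [negEntropy]
  linarith

lemma negEntropy_nonpos (hr1 : ∑ i, r i = 1) {A : Matrix (Fin n) (Fin n) ℝ}
    (hA : A ∈ transportPolytope r c) : negEntropy A ≤ 0 := by
  have h0 := (mem_transportPolytope.1 hA)
  refine Finset.sum_nonpos fun i _ => Finset.sum_nonpos fun j _ => ?_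
  refine mul_nonpos_of_nonneg_of_nonpos (h0.2.2 i j) (Real.log_nonpos (h0.2.2 i j) ?_)
  have hr0 : ∀ i, 0 ≤ r i := fun i => h0.1 i ▸ Finset.sum_nonneg fun j _ => h0.2.2 i j
  exact (le_of_mem_transportPolytope hA i j).trans
    (hr1 ▸ Finset.single_le_sum (fun i _ => hr0 i) (Finset.mem_univ i))

/-- Nonnegativity of the relative entropy to the uniform distribution on the `n²` cells. -/
lemma le_negEntropy (hr1 : ∑ i, r i = 1) {A : Matrix (Fin n) (Fin n) ℝ}
    (hA : A ∈ transportPolytope r c) : -(2 * Real.log n) ≤ negEntropy A := by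
  have hn : n ≠ 0 := by rintro rfl; simp at hr1
  have hn' : (n : ℝ) ≠ 0 := by exact_mod_cast hn
  have h1 := sum_of_mem_transportPolytope hr1 hA
  have h := relEntropy_nonneg (p := fun k : Fin n × Fin n => A k.1 k.2)
    (q := fun k => ((n : ℝ) ^ 2)⁻¹) (fun k => (mem_transportPolytope.1 hA).2.2 _ _)
    (fun k => by positivity) (by
      rw [Fintype.sum_prod_type, h1]
      simp
      field_simp)
  rw [relEntropy, Fintype.sum_prod_type] at h
  simp only [mul_sub, Finset.sum_sub_distrib, ← Finset.sum_mul, h1, Real.log_inv,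
    Real.log_pow] at h
  simp only [negEntropy]
  push_cast at h
  linarith

lemma add_mul_log_le {u v : ℝ} (hu : 0 ≤ u) (hv : 0 ≤ v) :
    u * Real.log u + v * Real.log v ≤ (u + v) * Real.log (u + v) := by
  rw [add_mul]
  refine add_le_add ?_ ?_
  · rcases hu.eq_or_lt with rfl | hu
    · simp
    · exact mul_le_mul_of_nonneg_left (Real.log_le_log hu (by linarith)) hu.le
  · rcases hv.eq_or_lt with rfl | hv
    · simp
    · exact mul_le_mul_of_nonneg_left (Real.log_le_log hv (by linarith)) hv.le

lemma mul_log_mul (a u : ℝ) :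
    (a * u) * Real.log (a * u) = u * (a * Real.log a) + a * (u * Real.log u) := by
  rcases eq_or_ne a 0 with rfl | ha
  · simp
  rcases eq_or_ne u 0 with rfl | hu
  · simp
  rw [Real.log_mul ha hu]
  ring

/-- The entropy of a combination exceeds the weighted entropies by at most the entropy of the
weights, because `u log u` is superadditive. -/
lemma le_negEntropy_combo (hr1 : ∑ i, r i = 1) {A B : Matrix (Fin n) (Fin n) ℝ}
    (hA : A ∈ transportPolytope r c) (hB : B ∈ transportPolytope r c) {a b : ℝ}
    (ha : 0 ≤ a) (hb : 0 ≤ b) :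
    a * Real.log a + a * negEntropy A + (b * Real.log b + b * negEntropy B) ≤
      negEntropy (a • A + b • B) := by
  have h1 : ∀ (s : ℝ) (D : Matrix (Fin n) (Fin n) ℝ), D ∈ transportPolytope r c →
      s * Real.log s + s * negEntropy D = ∑ i, ∑ j, (s * D i j) * Real.log (s * D i j) := by
    intro s D hD
    simp only [mul_log_mul, Finset.sum_add_distrib, ← Finset.sum_mul, ← Finset.mul_sum,
      sum_of_mem_transportPolytope hr1 hD, one_mul, negEntropy]
  rw [h1 a A hA, h1 b B hB, negEntropy]
  simp only [← Finset.sum_add_distrib]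
  refine Finset.sum_le_sum fun i _ => Finset.sum_le_sum fun j _ => ?_
  exact add_mul_log_le (mul_nonneg ha ((mem_transportPolytope.1 hA).2.2 i j))
    (mul_nonneg hb ((mem_transportPolytope.1 hB).2.2 i j))

lemma l1Norm_eq_one (hr1 : ∑ i, r i = 1) {A : Matrix (Fin n) (Fin n) ℝ}
    (hA : A ∈ transportPolytope r c) : l1Norm A = 1 := by
  simp [l1Norm, abs_of_nonneg ((mem_transportPolytope.1 hA).2.2 _ _),
    sum_of_mem_transportPolytope hr1 hA]

/-- The entropically regularized plan is exponentially close to the optimal face. -/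
lemma exists_mem_optimalFace_l1Norm_le (hr1 : ∑ i, r i = 1)
    (hne : (vertices r c \ optimalVertices C r c).Nonempty) (hη : 0 < η)
    (hP : plan η C x y ∈ transportPolytope r c) :
    ∃ A ∈ optimalFace C r c,
      l1Norm (A - plan η C x y) ≤ 6 * (n : ℝ) ^ 2 * Real.exp (-η * vertexGap C r c) := by
  have hn : n ≠ 0 := by rintro rfl; simp at hr1
  have hn' : (0 : ℝ) < n := by exact_mod_cast Nat.pos_of_ne_zero hn
  obtain ⟨A, hA, B, hB, a, ha0, ha1, hdec⟩ := exists_decomposition hne hP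
  have hAt := optimalFace_subset hA
  have hBt : B ∈ transportPolytope r c := by
    rw [← convexHull_vertices]
    exact convexHull_mono Set.sdiff_subset hB
  refine ⟨A, hA, ?_⟩
  have hbound : a ≤ Real.exp 1 * (n : ℝ) ^ 2 * Real.exp (-η * vertexGap C r c) := by
    rcases ha0.eq_or_lt with rfl | ha
    · positivity
    have h1 := regularized_cost_le hr1 hP hAt
    rw [hdec, cost_combo] at h1
    have h2 := le_negEntropy_combo hr1 hAt hBt (sub_nonneg.2 ha1) ha0
    have h3 := negEntropy_nonpos hr1 hAt
    have h4 := le_negEntropy hr1 hBt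
    have h5 := vertexGap_le hA hB
    -- A bound linear in `a`: every term of the comparison then carries a factor `a`, which cancels
    -- to leave a bound on `log a`.
    have h6 : -a ≤ (1 - a) * Real.log (1 - a) := by
      rcases ha1.eq_or_lt with rfl | ha1
      · simp
      · have h := Real.one_sub_inv_le_log_of_pos (sub_pos.2 ha1)
        have h' := mul_le_mul_of_nonneg_left h (sub_pos.2 ha1).le
        rw [mul_sub, mul_inv_cancel₀ (sub_pos.2 ha1).ne'] at h'
        linarith
    have h7 : a * (Real.log a) ≤ a * (1 + 2 * Real.log n - η * vertexGap C r c) := by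
      have e1 : η * (a * vertexGap C r c) ≤ η * (a * (cost C B - cost C A)) := by
        gcongr
        linarith
      have e2 := mul_le_mul_of_nonneg_left h4 ha0
      have e3 := mul_nonpos_of_nonneg_of_nonpos ha0 h3
      nlinarith
    have h8 := le_of_mul_le_mul_left h7 ha
    rw [Real.log_le_iff_le_exp ha] at h8
    refine h8.trans_eq ?_
    rw [sub_eq_add_neg, Real.exp_add, Real.exp_add, two_mul, Real.exp_add, Real.exp_log hn',
      neg_mul]
    ring
  -- The distance is `a` times that of two probability matrices, hence at most `2a`; the final
  -- constant comes from `2e < 6`.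
  have hAP : A - plan η C x y = a • (A + (-1 : ℝ) • B) := by
    rw [hdec]; module
  have h9 : l1Norm (A + (-1 : ℝ) • B) ≤ 2 := by
    refine (l1Norm_add_le _ _).trans_eq ?_
    rw [l1Norm_smul, l1Norm_eq_one hr1 hAt, l1Norm_eq_one hr1 hBt]
    norm_num
  rw [hAP, l1Norm_smul, abs_of_nonneg ha0]
  have h10 := Real.exp_one_lt_d9
  calc a * l1Norm (A + (-1 : ℝ) • B) ≤ a * 2 := by gcongr
    _ ≤ (Real.exp 1 * (n : ℝ) ^ 2 * Real.exp (-η * vertexGap C r c)) * 2 := by gcongr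
    _ = (2 * Real.exp 1) * ((n : ℝ) ^ 2 * Real.exp (-η * vertexGap C r c)) := by ring
    _ ≤ 6 * ((n : ℝ) ^ 2 * Real.exp (-η * vertexGap C r c)) := by
      gcongr
      linarith
    _ = _ := by ring

end Plan

/-! ### Sinkhorn iterations: dual ascent and convergence rate. -/

section Sinkhorn

variable {n : ℕ} {C : Matrix (Fin n) (Fin n) ℝ} {r c x y : Fin n → ℝ} {η : ℝ}

lemma plan_add_add (u v : Fin n → ℝ) (i j : Fin n) :
    plan η C (x + u) (y + v) i j = plan η C x y i j * Real.exp (η * (u i + v j)) := by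
  simp only [plan, Matrix.of_apply, ← Real.exp_add, Pi.add_apply]
  congr 1
  ring

/-- The gauge freedom of the dual, used to normalize a row potential into a compact box. -/
lemma plan_add_const (a : ℝ) :
    plan η C (fun i => x i - a) (fun j => y j + a) = plan η C x y := by
  ext i j
  simp only [plan, Matrix.of_apply]
  congr 1
  ring

lemma plan_mulVec_one (i : Fin n) :
    (plan η C x y *ᵥ (fun _ => 1)) i = ∑ j, plan η C x y i j := by
  simp [Matrix.mulVec, dotProduct]

lemma plan_transpose_mulVec_one (j : Fin n) :
    ((plan η C x y)ᵀ *ᵥ (fun _ => 1)) j = ∑ i, plan η C x y i j := by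
  simp [Matrix.mulVec, dotProduct]

lemma sum_plan_row_pos (i : Fin n) : 0 < ∑ j, plan η C x y i j :=
  Finset.sum_pos (fun _ _ => plan_pos _ _) ⟨i, Finset.mem_univ _⟩

lemma sum_plan_col_pos (j : Fin n) : 0 < ∑ i, plan η C x y i j :=
  Finset.sum_pos (fun _ _ => plan_pos _ _) ⟨j, Finset.mem_univ _⟩

lemma sum_plan_rowUpdate (hη : 0 < η) (hr : ∀ i, 0 < r i) (i : Fin n) :
    ∑ j, plan η C (rowUpdate η C r x y) y i j = r i := by
  have h : ∀ j, plan η C (rowUpdate η C r x y) y i j =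
      plan η C x y i j * (r i / ∑ j, plan η C x y i j) := fun j => by
    have h := plan_add_add (η := η) (C := C) (x := x) (y := y) (rowUpdate η C r x y - x) 0 i j
    rw [add_sub_cancel, add_zero] at h
    rw [h]
    simp only [rowUpdate, plan_mulVec_one, Pi.sub_apply, Pi.zero_apply, add_zero,
      add_sub_cancel_left]
    rw [mul_div_cancel₀ _ hη.ne', Real.exp_sub, Real.exp_log (hr i),
      Real.exp_log (sum_plan_row_pos i)]
  simp only [h, ← Finset.sum_mul]
  exact mul_div_cancel₀ _ (sum_plan_row_pos i).ne'

lemma sum_plan_colUpdate (hη : 0 < η) (hc : ∀ j, 0 < c j) (j : Fin n) :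
    ∑ i, plan η C x (colUpdate η C c x y) i j = c j := by
  have h : ∀ i, plan η C x (colUpdate η C c x y) i j =
      plan η C x y i j * (c j / ∑ i, plan η C x y i j) := fun i => by
    have h := plan_add_add (η := η) (C := C) (x := x) (y := y) 0 (colUpdate η C c x y - y) i j
    rw [add_sub_cancel, add_zero] at h
    rw [h]
    simp only [colUpdate, plan_transpose_mulVec_one, Pi.sub_apply, Pi.zero_apply, zero_add,
      add_sub_cancel_left]
    rw [mul_div_cancel₀ _ hη.ne', Real.exp_sub, Real.exp_log (hc j),
      Real.exp_log (sum_plan_col_pos j)]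
  simp only [h, ← Finset.sum_mul]
  exact mul_div_cancel₀ _ (sum_plan_col_pos j).ne'

lemma sum_plan_eq_one (hc1 : ∑ j, c j = 1) (h : ∀ j, ∑ i, plan η C x y i j = c j) :
    ∑ i, ∑ j, plan η C x y i j = 1 := by
  simp only [← hc1, ← h]
  exact Finset.sum_comm

/-- The linear part of the Lyapunov potential. -/
noncomputable def dualValue (r c : Fin n → ℝ) (z : (Fin n → ℝ) × (Fin n → ℝ)) : ℝ :=
  ∑ i, r i * z.1 i + ∑ j, c j * z.2 j

lemma mul_dualValue_rowUpdate_sub (hη : 0 < η) :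
    η * (dualValue r c (rowUpdate η C r x y, y) - dualValue r c (x, y)) =
      relEntropy r (fun i => ∑ j, plan η C x y i j) := by
  simp only [dualValue, relEntropy, rowUpdate, plan_mulVec_one, add_sub_add_right_eq_sub,
    ← Finset.sum_sub_distrib, Finset.mul_sum]
  refine Finset.sum_congr rfl fun i _ => ?_
  field_simp
  ring

lemma mul_dualValue_colUpdate_sub (hη : 0 < η) :
    η * (dualValue r c (x, colUpdate η C c x y) - dualValue r c (x, y)) =
      relEntropy c (fun j => ∑ i, plan η C x y i j) := by
  simp only [dualValue, relEntropy, colUpdate, plan_transpose_mulVec_one,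
    add_sub_add_left_eq_sub, ← Finset.sum_sub_distrib, Finset.mul_sum]
  refine Finset.sum_congr rfl fun i _ => ?_
  field_simp
  ring

/-- Each Sinkhorn iteration improves the dual value by at least the relative entropy of the
row marginals. -/
lemma relEntropy_le_mul_dualValue_sinkhornStep (hη : 0 < η) (hr : ∀ i, 0 < r i)
    (hc : ∀ j, 0 < c j) (hr1 : ∑ i, r i = 1) (hc1 : ∑ j, c j = 1) :
    relEntropy r (fun i => ∑ j, plan η C x y i j) ≤
      η * (dualValue r c (sinkhornStep η C r c (x, y)) - dualValue r c (x, y)) := by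
  have h1 := mul_dualValue_rowUpdate_sub (C := C) (r := r) (c := c) (x := x) (y := y) hη
  have h2 := mul_dualValue_colUpdate_sub (C := C) (r := r) (c := c)
    (x := rowUpdate η C r x y) (y := y) hη
  have h3 : 0 ≤ relEntropy c (fun j => ∑ i, plan η C (rowUpdate η C r x y) y i j) := by
    refine relEntropy_nonneg (fun j => (hc j).le) (fun j => sum_plan_col_pos j) ?_
    rw [Finset.sum_comm]
    simp only [sum_plan_rowUpdate hη hr, hr1, hc1]
  simp only [sinkhornStep]
  linarith

lemma sum_plan_sinkhornStep (hη : 0 < η) (hc : ∀ j, 0 < c j)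
    (z : (Fin n → ℝ) × (Fin n → ℝ)) (j : Fin n) :
    ∑ i, plan η C (sinkhornStep η C r c z).1 (sinkhornStep η C r c z).2 i j = c j :=
  sum_plan_colUpdate hη hc j

/-- A bound for the oscillation of a dual variable obtained from a row scaling. -/
noncomputable def oscBound (η : ℝ) (C : Matrix (Fin n) (Fin n) ℝ) (r : Fin n → ℝ) : ℝ :=
  2 * l1Norm C + 2 * (∑ i, |Real.log (r i)|) / η

lemma oscBound_nonneg (hη : 0 < η) : 0 ≤ oscBound η C r := by
  have := l1Norm_nonneg C
  unfold oscBound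
  positivity

/-- Rows `i` and `k` share the factors from `y`, so their entrywise ratio is at least `exp (η (x i -
x k - 2‖C‖₁))`. Summing and taking logarithms eliminates `y`, hence all memory of the starting
point. -/
lemma sub_le_oscBound (hη : 0 < η) (hr : ∀ i, 0 < r i)
    (h : ∀ i, ∑ j, plan η C x y i j = r i) (i k : Fin n) : x i - x k ≤ oscBound η C r := by
  have hC : ∀ i j, |C i j| ≤ l1Norm C := fun i j =>
    (Finset.single_le_sum (f := fun j => |C i j|) (fun _ _ => abs_nonneg _)
      (Finset.mem_univ j)).trans
      (Finset.single_le_sum (f := fun i => ∑ j, |C i j|)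
        (fun _ _ => Finset.sum_nonneg fun _ _ => abs_nonneg _) (Finset.mem_univ i))
  have hL : ∀ i, |Real.log (r i)| ≤ ∑ i, |Real.log (r i)| := fun i =>
    Finset.single_le_sum (f := fun i => |Real.log (r i)|) (fun _ _ => abs_nonneg _)
      (Finset.mem_univ i)
  have h1 : r k * Real.exp (η * (x i - x k - 2 * l1Norm C)) ≤ r i := by
    rw [← h k, ← h i, Finset.sum_mul]
    refine Finset.sum_le_sum fun j _ => ?_
    rw [plan, Matrix.of_apply, Matrix.of_apply, ← Real.exp_add, Real.exp_le_exp]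
    have e1 := (abs_le.1 (hC i j)).2
    have e2 := (abs_le.1 (hC k j)).1
    have : η * (-(2 * l1Norm C) - C k j + C i j) ≤ 0 :=
      mul_nonpos_of_nonneg_of_nonpos hη.le (by linarith)
    linarith
  have h2 := Real.log_le_log (mul_pos (hr k) (Real.exp_pos _)) h1
  rw [Real.log_mul (hr k).ne' (Real.exp_pos _).ne', Real.log_exp] at h2
  have h3 := (abs_le.1 (hL i)).2
  have h4 := (abs_le.1 (hL k)).1
  have h5 : x i - x k - 2 * l1Norm C ≤ 2 * (∑ i, |Real.log (r i)|) / η := by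
    rw [le_div_iff₀ hη]
    linarith
  unfold oscBound
  linarith

/-- The column dual variable that matches the column marginals for a given row dual variable. -/
noncomputable def colDual (η : ℝ) (C : Matrix (Fin n) (Fin n) ℝ) (c x : Fin n → ℝ) :
    Fin n → ℝ := colUpdate η C c x 0

lemma eq_colDual (hη : 0 < η) (h : ∀ j, ∑ i, plan η C x y i j = c j) : y = colDual η C c x := by
  ext j
  have h1 : c j = (∑ i, plan η C x 0 i j) * Real.exp (η * y j) := by
    rw [← h j, Finset.sum_mul]
    refine Finset.sum_congr rfl fun i _ => ?_
    have := plan_add_add (η := η) (C := C) (x := x) (y := 0) 0 y i j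
    simpa using this
  have h2 : Real.log (c j) = Real.log (∑ i, plan η C x 0 i j) + η * y j := by
    rw [h1, Real.log_mul (sum_plan_col_pos j).ne' (Real.exp_pos _).ne', Real.log_exp]
  simp only [colDual, colUpdate, plan_transpose_mulVec_one, h2, Pi.zero_apply]
  field_simp
  ring

lemma continuous_dualValue_colDual :
    Continuous fun x => dualValue r c (x, colDual η C c x) := by
  simp only [dualValue, colDual, colUpdate, plan_transpose_mulVec_one]
  have h : ∀ j, Continuous fun x => Real.log (∑ i, plan η C x 0 i j) := fun j => by
    refine Continuous.log ?_ fun x => (sum_plan_col_pos j).ne'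
    simp only [plan, Matrix.of_apply]
    fun_prop
  fun_prop

/-- Existence of dual variables whose plan has the prescribed marginals. -/
lemma exists_plan_mem_transportPolytope (hη : 0 < η) (hr : ∀ i, 0 < r i)
    (hc : ∀ j, 0 < c j) (hr1 : ∑ i, r i = 1) (hc1 : ∑ j, c j = 1) (C : Matrix (Fin n) (Fin n) ℝ) :
    ∃ x y, plan η C x y ∈ transportPolytope r c := by
  have hn : n ≠ 0 := by rintro rfl; simp at hr1
  have : NeZero n := ⟨hn⟩
  have hK : IsCompact (Set.univ.pi fun _ : Fin n =>
      Set.Icc (-oscBound η C r) (oscBound η C r)) :=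
    isCompact_univ_pi fun _ => isCompact_Icc
  -- The maximizer over the box need not be interior: up to gauge a Sinkhorn step lands in the box
  -- again, so it cannot raise the dual value, and the row error must vanish.
  obtain ⟨x, -, hx⟩ := hK.exists_isMaxOn
    ⟨0, fun i _ => ⟨by simpa using oscBound_nonneg hη, oscBound_nonneg hη⟩⟩
    (continuous_dualValue_colDual (r := r) (c := c) (η := η) (C := C)).continuousOn
  set y := colDual η C c x with hy
  have hcol : ∀ j, ∑ i, plan η C x y i j = c j := sum_plan_colUpdate hη hc
  have htot : ∑ i, ∑ j, plan η C x y i j = 1 := sum_plan_eq_one hc1 hcol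
  set z := sinkhornStep η C r c (x, y) with hz
  have hosc := sub_le_oscBound (η := η) (C := C) (r := r) (x := z.1) (y := y) hη hr
    (fun i => sum_plan_rowUpdate hη hr i)
  set x' : Fin n → ℝ := fun i => z.1 i - z.1 0 with hx'
  have hy' : (fun j => z.2 j + z.1 0) = colDual η C c x' := by
    refine eq_colDual hη fun j => ?_
    rw [plan_add_const]
    exact sum_plan_sinkhornStep hη hc _ j
  have hval : dualValue r c (x', colDual η C c x') = dualValue r c z := by
    rw [← hy']
    simp only [dualValue, hx', mul_sub, mul_add, Finset.sum_sub_distrib, Finset.sum_add_distrib,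
      ← Finset.sum_mul, hr1, hc1]
    ring
  have hle : dualValue r c z ≤ dualValue r c (x, y) := by
    rw [← hval]
    exact hx fun i _ => ⟨by simp only [hx']; linarith [hosc 0 i], hosc i 0⟩
  have hent := relEntropy_le_mul_dualValue_sinkhornStep (C := C) (x := x) (y := y) hη hr hc hr1 hc1
  have hent0 : relEntropy r (fun i => ∑ j, plan η C x y i j) ≤ 0 :=
    hent.trans (mul_nonpos_of_nonneg_of_nonpos hη.le (sub_nonpos.2 hle))
  have hsq := sq_sum_abs_sub_le (fun i => (hr i).le) (fun i => sum_plan_row_pos i) hr1 htot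
  have hzero : ∑ i, |r i - ∑ j, plan η C x y i j| = 0 :=
    pow_eq_zero_iff two_ne_zero |>.1 (le_antisymm (by linarith) (sq_nonneg _))
  refine ⟨x, y, mem_transportPolytope.2 ⟨fun i => ?_, hcol, fun i j => (plan_pos i j).le⟩⟩
  have := (Finset.sum_eq_zero_iff_of_nonneg fun _ _ => abs_nonneg _).1 hzero i (Finset.mem_univ i)
  linarith [abs_eq_zero.1 this]

/-- The log-ratio of two plans is a sum of a row and a column function, so only marginals enter. The
marginals are arbitrary because the roles of regularized plan and iterate are later exchanged. -/
lemma relEntropy_plan_plan {x' y' : Fin n → ℝ} (hP : plan η C x y ∈ transportPolytope r c) :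
    relEntropy (fun k : Fin n × Fin n => plan η C x y k.1 k.2) (fun k => plan η C x' y' k.1 k.2) =
      η * (dualValue r c (x, y) - dualValue r c (x', y')) := by
  have h1 := sum_mul_add hP (x - x') (y - y')
  rw [relEntropy, Fintype.sum_prod_type]
  have h2 : η * (dualValue r c (x, y) - dualValue r c (x', y')) =
      η * (∑ i, r i * (x - x') i + ∑ j, c j * (y - y') j) := by
    simp only [dualValue, Pi.sub_apply, mul_sub, Finset.sum_sub_distrib]
    ring
  rw [h2, ← h1]
  simp only [Finset.mul_sum, log_plan, Pi.sub_apply]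
  exact Finset.sum_congr rfl fun i _ => Finset.sum_congr rfl fun j _ => by ring

lemma sum_mul_le_of_osc_le {u w : Fin n → ℝ} {D : ℝ} (hu : ∑ i, u i = 0)
    (hw : ∀ i k, w i - w k ≤ D) : ∑ i, u i * w i ≤ D * ∑ i, |u i| := by
  rcases n with _ | n
  · simp
  have h : ∑ i, u i * w i = ∑ i, u i * (w i - w 0) := by
    simp [mul_sub, ← Finset.sum_mul, hu]
  rw [h, Finset.mul_sum]
  refine Finset.sum_le_sum fun i _ => ?_
  calc u i * (w i - w 0) ≤ |u i| * |w i - w 0| := by rw [← abs_mul]; exact le_abs_self _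
    _ ≤ |u i| * D := by
      gcongr
      exact abs_le.2 ⟨by linarith [hw 0 i], hw i 0⟩
    _ = D * |u i| := mul_comm _ _

/-- The recursion says that `1 / d` grows by at least `1 / K` per step; `h3` is this with
denominators cleared. -/
lemma le_div_of_sq_le {d : ℕ → ℝ} {K : ℝ} (hK : 0 < K) (hd : ∀ s, 0 ≤ d s)
    (h : ∀ s, d s ^ 2 ≤ K * (d s - d (s + 1))) (s : ℕ) : ((s : ℝ) + 1) * d s ≤ K := by
  induction s with
  | zero =>
    by_contra! hlt
    have := h 0
    have := hd 1
    norm_num at *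
    nlinarith
  | succ s ih =>
    have h1 := h s
    have h2 : d (s + 1) ≤ d s := by
      by_contra! hlt
      nlinarith [sq_nonneg (d s)]
    have h3 : d (s + 1) * (K + d s) ≤ K * d s := by nlinarith [hd s]
    have h4 : 0 < K + d s := by linarith [hd s]
    refine le_of_mul_le_mul_right ?_ h4
    push_cast
    calc ((s : ℝ) + 1 + 1) * d (s + 1) * (K + d s)
        = ((s : ℝ) + 1 + 1) * (d (s + 1) * (K + d s)) := by ring
      _ ≤ ((s : ℝ) + 1 + 1) * (K * d s) := by gcongr
      _ = K * (((s : ℝ) + 1) * d s + d s) := by ring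
      _ ≤ K * (K + d s) := by gcongr

lemma sinkhornDual_succ (x₀ y₀ : Fin n → ℝ) (t : ℕ) :
    sinkhornDual η C r c x₀ y₀ (t + 1) = sinkhornStep η C r c (sinkhornDual η C r c x₀ y₀ t) :=
  Function.iterate_succ_apply' _ _ _

/-- Sinkhorn iterates converge to the regularized plan at rate `O(1/√t)`, uniformly in the
initialization. -/
lemma l1Norm_plan_sub_sinkhornPlan_le (hη : 0 < η) (hr : ∀ i, 0 < r i)
    (hc : ∀ j, 0 < c j) (hr1 : ∑ i, r i = 1) (hc1 : ∑ j, c j = 1)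
    (hP : plan η C x y ∈ transportPolytope r c) (x₀ y₀ : Fin n → ℝ) {t : ℕ} (ht : 0 < t) :
    l1Norm (plan η C x y - sinkhornPlan η C r c x₀ y₀ t) ≤
      √(4 * (4 * (η * (2 * oscBound η C r)) ^ 2 + 1)) / √(t : ℝ) := by
  obtain ⟨s, rfl⟩ := Nat.exists_eq_succ_of_ne_zero ht.ne'
  set z := sinkhornDual η C r c x₀ y₀ with hz
  set D := oscBound η C r with hD
  set R : ℕ → Fin n → ℝ := fun t i => ∑ j, plan η C (z t).1 (z t).2 i j with hR
  have hcol : ∀ s j, ∑ i, plan η C (z (s + 1)).1 (z (s + 1)).2 i j = c j := fun s j => by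
    rw [hz, sinkhornDual_succ]
    exact sum_plan_sinkhornStep hη hc _ j
  have htot : ∀ s, ∑ i, R (s + 1) i = 1 := fun s => sum_plan_eq_one hc1 (hcol s)
  have hmem : ∀ s, plan η C (z (s + 1)).1 (z (s + 1)).2 ∈ transportPolytope (R (s + 1)) c :=
    fun s => mem_transportPolytope.2 ⟨fun i => rfl, hcol s, fun i j => (plan_pos i j).le⟩
  have hosc : ∀ s i k, (z (s + 1)).1 i - (z (s + 1)).1 k ≤ D := fun s i k => by
    refine sub_le_oscBound (y := (z s).2) hη hr (fun i => ?_) i k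
    rw [hz, sinkhornDual_succ]
    exact sum_plan_rowUpdate hη hr i
  have hosc' := sub_le_oscBound hη hr (mem_transportPolytope.1 hP).1
  have hsum1 : ∀ s, ∑ k : Fin n × Fin n, plan η C (z (s + 1)).1 (z (s + 1)).2 k.1 k.2 = 1 :=
    fun s => by
      rw [Fintype.sum_prod_type]
      exact htot s
  have hsumP : ∑ k : Fin n × Fin n, plan η C x y k.1 k.2 = 1 := by
    rw [Fintype.sum_prod_type]
    exact sum_of_mem_transportPolytope hr1 hP
  -- The index is shifted by one: column marginals and oscillation are controlled only after the
  -- first iteration.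
  set d : ℕ → ℝ := fun s => relEntropy (fun k : Fin n × Fin n => plan η C x y k.1 k.2)
    (fun k => plan η C (z (s + 1)).1 (z (s + 1)).2 k.1 k.2) with hd
  have hd' : ∀ s, d s = η * (dualValue r c (x, y) - dualValue r c (z (s + 1))) :=
    fun s => relEntropy_plan_plan hP
  have hd0 : ∀ s, 0 ≤ d s := fun s =>
    relEntropy_nonneg (fun k => (plan_pos _ _).le) (fun k => plan_pos _ _)
      (hsumP.trans (hsum1 s).symm)
  have hdec : ∀ s, (∑ i, |r i - R (s + 1) i|) ^ 2 ≤ 4 * (d s - d (s + 1)) := fun s => by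
    have h1 := relEntropy_le_mul_dualValue_sinkhornStep (C := C) (x := (z (s + 1)).1)
      (y := (z (s + 1)).2) hη hr hc hr1 hc1
    have h2 := sq_sum_abs_sub_le (q := R (s + 1)) (fun i => (hr i).le)
      (fun i => sum_plan_row_pos i) hr1 (htot s)
    have h3 : z (s + 1 + 1) = sinkhornStep η C r c (z (s + 1)) := sinkhornDual_succ _ _ _
    rw [hd', hd', h3]
    linarith
  -- Adding the reverse relative entropy, which is nonnegative, leaves only the row error paired
  -- with the difference of row potentials, as the columns agree. Each potential oscillates by at
  -- most `D`.
  have hupper : ∀ s, d s ≤ η * (2 * D) * ∑ i, |r i - R (s + 1) i| := fun s => by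
    have h1 := relEntropy_nonneg
      (p := fun k : Fin n × Fin n => plan η C (z (s + 1)).1 (z (s + 1)).2 k.1 k.2)
      (q := fun k => plan η C x y k.1 k.2) (fun k => (plan_pos _ _).le) (fun k => plan_pos _ _)
      ((hsum1 s).trans hsumP.symm)
    rw [relEntropy_plan_plan (hmem s)] at h1
    have h2 : d s + η * (dualValue (R (s + 1)) c ((z (s + 1)).1, (z (s + 1)).2) -
        dualValue (R (s + 1)) c (x, y)) =
        η * ∑ i, (r i - R (s + 1) i) * (x i - (z (s + 1)).1 i) := by
      rw [hd']
      simp only [dualValue, sub_mul, mul_sub, Finset.sum_sub_distrib]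
      ring
    have h3 := sum_mul_le_of_osc_le (u := fun i => r i - R (s + 1) i)
      (w := fun i => x i - (z (s + 1)).1 i) (D := 2 * D)
      (by rw [Finset.sum_sub_distrib, hr1, htot, sub_self])
      (fun i k => by linarith [hosc' i k, hosc s k i])
    have h4 := mul_le_mul_of_nonneg_left h3 hη.le
    linarith
  -- The summand 1 keeps the constant positive even if `D = 0`.
  have hK : 0 < 4 * (η * (2 * D)) ^ 2 + 1 := by positivity
  have hrec : ∀ s, d s ^ 2 ≤ (4 * (η * (2 * D)) ^ 2 + 1) * (d s - d (s + 1)) := fun s => by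
    have h1 := pow_le_pow_left₀ (hd0 s) (hupper s) 2
    rw [mul_pow] at h1
    have h2 := mul_le_mul_of_nonneg_left (hdec s) (sq_nonneg (η * (2 * D)))
    have h3 : 0 ≤ d s - d (s + 1) := by
      linarith [hdec s, sq_nonneg (∑ i, |r i - R (s + 1) i|)]
    linarith
  have hrate := le_div_of_sq_le hK hd0 hrec s
  have hpin := sq_sum_abs_sub_le (p := fun k : Fin n × Fin n => plan η C x y k.1 k.2)
    (q := fun k => plan η C (z (s + 1)).1 (z (s + 1)).2 k.1 k.2)
    (fun k => (plan_pos _ _).le) (fun k => plan_pos _ _) hsumP (hsum1 s)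
  rw [Fintype.sum_prod_type] at hpin
  have hs : (0 : ℝ) < ((s + 1 : ℕ) : ℝ) := by positivity
  rw [← Real.sqrt_div (by positivity)]
  refine Real.le_sqrt_of_sq_le (le_trans hpin ?_)
  rw [le_div_iff₀ hs]
  push_cast
  have : d s = relEntropy (fun k : Fin n × Fin n => plan η C x y k.1 k.2)
    (fun k => plan η C (z (s + 1)).1 (z (s + 1)).2 k.1 k.2) := rfl
  rw [← this]
  linarith

end Sinkhorn

/-! ### The Hessian in block form and its sparsity. -/

section Hessian

variable {n : ℕ} {C : Matrix (Fin n) (Fin n) ℝ} {r c x y : Fin n → ℝ} {η : ℝ}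

/-- The linear functional `z ↦ x_i + y_j` on the joint dual variable. -/
noncomputable def pairSum (i j : Fin n) : (Fin n ⊕ Fin n → ℝ) →L[ℝ] ℝ :=
  ContinuousLinearMap.proj (R := ℝ) (φ := fun _ : Fin n ⊕ Fin n => ℝ) (Sum.inl i) +
    ContinuousLinearMap.proj (R := ℝ) (φ := fun _ : Fin n ⊕ Fin n => ℝ) (Sum.inr j)

@[simp] lemma pairSum_apply (i j : Fin n) (z : Fin n ⊕ Fin n → ℝ) :
    pairSum i j z = z (Sum.inl i) + z (Sum.inr j) := rfl

lemma hasFDerivAt_exp_pairSum (i j : Fin n) (z : Fin n ⊕ Fin n → ℝ) :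
    HasFDerivAt (fun w : Fin n ⊕ Fin n → ℝ =>
        Real.exp (η * (-C i j + w (Sum.inl i) + w (Sum.inr j)) - 1))
      ((η * Real.exp (η * (-C i j + z (Sum.inl i) + z (Sum.inr j)) - 1)) • pairSum i j) z := by
  have h : HasFDerivAt (fun w : Fin n ⊕ Fin n → ℝ =>
      η * (-C i j + w (Sum.inl i) + w (Sum.inr j)) - 1) (η • pairSum i j) z := by
    have h1 := (((pairSum i j).hasFDerivAt (x := z)).const_mul η).add_const (-(η * C i j) - 1)
    refine h1.congr_of_eventuallyEq (Eventually.of_forall fun w => ?_)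
    simp only [pairSum_apply]
    ring
  refine h.exp.congr_fderiv ?_
  rw [smul_smul, mul_comm]

lemma fderiv_lyapunov_apply (hη : η ≠ 0) (z v : Fin n ⊕ Fin n → ℝ) :
    fderiv ℝ (lyapunov η C r c) z v =
      -(∑ i, ∑ j, Real.exp (η * (-C i j + z (Sum.inl i) + z (Sum.inr j)) - 1) * pairSum i j v)
        + ∑ i, r i * v (Sum.inl i) + ∑ j, c j * v (Sum.inr j) := by
  have h1 : HasFDerivAt (lyapunov η C r c)
      (-(1 / η) • (∑ i, ∑ j, (η * Real.exp (η * (-C i j + z (Sum.inl i) + z (Sum.inr j)) - 1)) •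
          pairSum i j)
        + ∑ i, r i • (ContinuousLinearMap.proj (Sum.inl i) : (Fin n ⊕ Fin n → ℝ) →L[ℝ] ℝ)
        + ∑ j, c j • (ContinuousLinearMap.proj (Sum.inr j) : (Fin n ⊕ Fin n → ℝ) →L[ℝ] ℝ)) z := by
    refine HasFDerivAt.add (HasFDerivAt.add ?_ ?_) ?_
    · exact (HasFDerivAt.fun_sum fun i _ => HasFDerivAt.fun_sum fun j _ =>
        hasFDerivAt_exp_pairSum i j z).const_mul _
    · exact HasFDerivAt.fun_sum fun i _ => ((ContinuousLinearMap.proj (R := ℝ)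
        (φ := fun _ : Fin n ⊕ Fin n => ℝ) (Sum.inl i)).hasFDerivAt).const_mul _
    · exact HasFDerivAt.fun_sum fun i _ => ((ContinuousLinearMap.proj (R := ℝ)
        (φ := fun _ : Fin n ⊕ Fin n => ℝ) (Sum.inr i)).hasFDerivAt).const_mul _
  rw [h1.fderiv]
  simp only [_root_.add_apply, _root_.smul_apply,
    _root_.sum_apply, ContinuousLinearMap.proj_apply, smul_eq_mul, Finset.mul_sum,
    ← Finset.sum_neg_distrib]
  congr 2
  refine Finset.sum_congr rfl fun i _ => Finset.sum_congr rfl fun j _ => ?_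
  field_simp

lemma hessian_lyapunov_apply (hη : η ≠ 0) (x y : Fin n → ℝ) (a b : Fin n ⊕ Fin n) :
    hessian (lyapunov η C r c) (Sum.elim x y) a b =
      -η * ∑ i, ∑ j, plan η C x y i j * pairSum i j (Pi.single a 1) *
        pairSum i j (Pi.single b 1) := by
  rw [hessian, Matrix.of_apply]
  simp only [fderiv_lyapunov_apply hη]
  have h1 : HasFDerivAt (fun w : Fin n ⊕ Fin n → ℝ =>
      -(∑ i, ∑ j, Real.exp (η * (-C i j + w (Sum.inl i) + w (Sum.inr j)) - 1) *
          pairSum i j (Pi.single b 1))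
        + ∑ i, r i * (Pi.single b 1 : Fin n ⊕ Fin n → ℝ) (Sum.inl i)
        + ∑ j, c j * (Pi.single b 1 : Fin n ⊕ Fin n → ℝ) (Sum.inr j))
      (-(∑ i, ∑ j, (pairSum i j (Pi.single b 1)) • ((η * plan η C x y i j) • pairSum i j)))
      (Sum.elim x y) := by
    refine HasFDerivAt.add_const _ (HasFDerivAt.add_const _ (HasFDerivAt.fun_neg ?_))
    exact HasFDerivAt.fun_sum fun i _ => HasFDerivAt.fun_sum fun j _ =>
      (hasFDerivAt_exp_pairSum i j (Sum.elim x y)).mul_const _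
  rw [h1.fderiv]
  simp only [_root_.neg_apply, _root_.smul_apply,
    _root_.sum_apply, smul_eq_mul, Finset.mul_sum, ← Finset.sum_neg_distrib]
  refine Finset.sum_congr rfl fun i _ => Finset.sum_congr rfl fun j _ => ?_
  ring

/-- The rescaled Hessian of the Lyapunov potential in block form. -/
lemma inv_smul_hessian_lyapunov (hη : η ≠ 0) (x y : Fin n → ℝ) :
    η⁻¹ • hessian (lyapunov η C r c) (Sum.elim x y) =
      Matrix.fromBlocks (Matrix.diagonal fun i => -∑ j, plan η C x y i j) (-plan η C x y)
        (-(plan η C x y)ᵀ) (Matrix.diagonal fun j => -∑ i, plan η C x y i j) := by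
  ext a b
  rw [Matrix.smul_apply, hessian_lyapunov_apply hη, smul_eq_mul, ← mul_assoc, mul_neg,
    inv_mul_cancel₀ hη, neg_one_mul]
  rcases a with a | a <;> rcases b with b | b
  · simp only [pairSum_apply, Pi.single_apply, Matrix.fromBlocks_apply₁₁, Matrix.diagonal_apply]
    by_cases hab : a = b
    · subst hab; simp
    · simp [hab, Ne.symm hab]
  · simp [Pi.single_apply]
  · simp [Pi.single_apply]
  · simp only [pairSum_apply, Pi.single_apply, Matrix.fromBlocks_apply₂₂, Matrix.diagonal_apply]
    by_cases hab : a = b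
    · subst hab; simp
    · simp [hab, Ne.symm hab]

lemma l1Norm_fromBlocks (A B D E : Matrix (Fin n) (Fin n) ℝ) :
    l1Norm (Matrix.fromBlocks A B D E) = l1Norm A + l1Norm B + (l1Norm D + l1Norm E) := by
  simp [l1Norm, Finset.sum_add_distrib]
  ring

lemma l1Norm_transpose (A : Matrix (Fin n) (Fin n) ℝ) : l1Norm Aᵀ = l1Norm A :=
  Finset.sum_comm

lemma l0Norm_eq_sum {ι κ : Type*} [Fintype ι] [Fintype κ] (M : Matrix ι κ ℝ) :
    l0Norm M = ∑ i, ∑ j, if M i j ≠ 0 then 1 else 0 := by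
  rw [l0Norm, Finset.card_filter, Fintype.sum_prod_type]

lemma l0Norm_fromBlocks (A B D E : Matrix (Fin n) (Fin n) ℝ) :
    l0Norm (Matrix.fromBlocks A B D E) = l0Norm A + l0Norm B + (l0Norm D + l0Norm E) := by
  simp only [l0Norm_eq_sum, Fintype.sum_sum_type, Finset.sum_add_distrib]
  exact add_add_add_comm _ _ _ _

lemma l0Norm_transpose (A : Matrix (Fin n) (Fin n) ℝ) : l0Norm Aᵀ = l0Norm A := by
  simp only [l0Norm_eq_sum, Matrix.transpose_apply]
  exact Finset.sum_comm

lemma l0Norm_neg (A : Matrix (Fin n) (Fin n) ℝ) : l0Norm (-A) = l0Norm A := by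
  simp [l0Norm]

lemma l0Norm_diagonal_le (v : Fin n → ℝ) : l0Norm (Matrix.diagonal v) ≤ n := by
  rw [l0Norm_eq_sum]
  calc _ ≤ ∑ i : Fin n, ∑ j, if i = j then 1 else 0 := by
        refine Finset.sum_le_sum fun i _ => Finset.sum_le_sum fun j _ => ?_
        by_cases h : i = j
        · rw [if_pos h]
          split_ifs <;> simp
        · simp [h]
    _ = n := by simp

/-- The diagonal blocks are kept exactly and `M` replaces the plan in both others: `2n + 2 l0Norm M`
nonzero entries among `4n²`, and twice the error. -/
lemma isApproxSparse_hessian (hη : η ≠ 0) (hn : n ≠ 0) {M : Matrix (Fin n) (Fin n) ℝ}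
    {lam eps : ℝ} (hM : sparsity M ≤ lam) (h : l1Norm (plan η C x y - M) ≤ eps) :
    IsApproxSparse (η⁻¹ • hessian (lyapunov η C r c) (Sum.elim x y))
      (lam / 2 + 1 / (2 * (n : ℝ))) (2 * eps) := by
  have hn' : (0 : ℝ) < n := by exact_mod_cast Nat.pos_of_ne_zero hn
  rw [inv_smul_hessian_lyapunov hη]
  refine ⟨Matrix.fromBlocks (Matrix.diagonal fun i => -∑ j, plan η C x y i j) (-M)
    (-Mᵀ) (Matrix.diagonal fun j => -∑ i, plan η C x y i j), ?_, ?_⟩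
  · have h1 : (l0Norm (Matrix.fromBlocks (Matrix.diagonal fun i => -∑ j, plan η C x y i j) (-M)
        (-Mᵀ) (Matrix.diagonal fun j => -∑ i, plan η C x y i j)) : ℝ) ≤
        2 * n + 2 * l0Norm M := by
      rw [l0Norm_fromBlocks, l0Norm_neg, l0Norm_neg, l0Norm_transpose]
      have e1 := l0Norm_diagonal_le fun i => -∑ j, plan η C x y i j
      have e2 := l0Norm_diagonal_le fun j => -∑ i, plan η C x y i j
      exact_mod_cast (by omega : _ ≤ 2 * n + 2 * l0Norm M)
    calc _ ≤ (2 * n + 2 * (l0Norm M : ℝ)) / ((n + n) * (n + n)) := by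
          rw [sparsity, Fintype.card_sum, Fintype.card_fin]
          push_cast
          gcongr
      _ = sparsity M / 2 + 1 / (2 * (n : ℝ)) := by
          rw [sparsity, Fintype.card_fin]
          field_simp
          ring
      _ ≤ _ := by gcongr
  · have h2 : Matrix.fromBlocks (Matrix.diagonal fun i => -∑ j, plan η C x y i j)
          (-plan η C x y) (-(plan η C x y)ᵀ) (Matrix.diagonal fun j => -∑ i, plan η C x y i j) -
        Matrix.fromBlocks (Matrix.diagonal fun i => -∑ j, plan η C x y i j) (-M)
          (-Mᵀ) (Matrix.diagonal fun j => -∑ i, plan η C x y i j) =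
        Matrix.fromBlocks 0 (M - plan η C x y) (M - plan η C x y)ᵀ 0 := by
      rw [sub_eq_add_neg, Matrix.fromBlocks_neg, Matrix.fromBlocks_add]
      congr 1 <;> simp <;> abel
    rw [h2, l1Norm_fromBlocks, l1Norm_transpose, l1Norm_sub_comm]
    have h0 : l1Norm (0 : Matrix (Fin n) (Fin n) ℝ) = 0 := by simp [l1Norm]
    rw [h0]
    linarith

end Hessian

/-! ### Generic costs and uniform marginals. -/

section Generic

variable {n : ℕ} {C : Matrix (Fin n) (Fin n) ℝ} {r c : Fin n → ℝ}

/-- The subspace is proper since it misses `D` itself, and a proper subspace is null. -/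
lemma volume_cost_eq_zero {D : Matrix (Fin n) (Fin n) ℝ} (hD : D ≠ 0) :
    MeasureTheory.volume {A : Fin n → Fin n → ℝ | cost (Matrix.of A) D = 0} = 0 := by
  let S : Submodule ℝ (Fin n → Fin n → ℝ) :=
    { carrier := {A | cost (Matrix.of A) D = 0}
      zero_mem' := by simp [cost]
      add_mem' := fun {A B} hA hB => by
        simp only [cost, Matrix.of_apply, Set.mem_ofPred_eq] at hA hB
        simp [cost, add_mul, Finset.sum_add_distrib, hA, hB]
      smul_mem' := fun a A hA => by
        simp only [cost, Matrix.of_apply, Set.mem_ofPred_eq] at hA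
        simp [cost, mul_assoc, ← Finset.mul_sum, hA] }
  refine MeasureTheory.Measure.addHaar_submodule _ S fun htop => hD ?_
  have hmem : (fun i j => D i j) ∈ S := htop ▸ Submodule.mem_top
  have h0 : ∑ i, ∑ j, D i j * D i j = 0 := hmem
  ext i j
  have h1 := (Finset.sum_eq_zero_iff_of_nonneg fun i _ =>
    Finset.sum_nonneg fun j _ => mul_self_nonneg (D i j)).1 h0 i (Finset.mem_univ i)
  have h2 := (Finset.sum_eq_zero_iff_of_nonneg fun j _ => mul_self_nonneg (D i j)).1 h1 j
    (Finset.mem_univ j)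
  simpa using h2

lemma exists_ne_vertices_of_mem_nonUniqueCosts (hC : C ∈ nonUniqueCosts r c) :
    ∃ V ∈ vertices r c, ∃ W ∈ vertices r c, V ≠ W ∧ cost C (V - W) = 0 := by
  obtain ⟨P, Q, hP, hQ, hPQ⟩ := hC
  rw [isOptimalPlan_iff] at hP hQ
  obtain ⟨V, hV, W, hW, hVW⟩ : (optimalVertices C r c).Nontrivial := by
    by_contra h
    rw [Set.not_nontrivial_iff] at h
    obtain ⟨V, hV⟩ := convexHull_nonempty_iff.1 ⟨P, hP⟩
    rw [optimalFace, h.eq_singleton_of_mem hV, convexHull_singleton] at hP hQ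
    exact hPQ (hP.trans hQ.symm)
  refine ⟨V, hV.1, W, hW.1, hVW, ?_⟩
  rw [← costLinear_apply, map_sub, costLinear_apply, costLinear_apply, sub_eq_zero]
  exact (hV.2 W hW.1).antisymm (hW.2 V hV.1)

lemma volume_nonUniqueCosts (r c : Fin n → ℝ) :
    MeasureTheory.volume {A : Fin n → Fin n → ℝ | Matrix.of A ∈ nonUniqueCosts r c} = 0 := by
  have hfin := finite_vertices r c
  have hsub : {A : Fin n → Fin n → ℝ | Matrix.of A ∈ nonUniqueCosts r c} ⊆
      ⋃ p ∈ (vertices r c ×ˢ vertices r c) ∩ {p | p.1 ≠ p.2},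
        {A : Fin n → Fin n → ℝ | cost (Matrix.of A) (p.1 - p.2) = 0} := by
    intro A hA
    obtain ⟨V, hV, W, hW, hVW, h0⟩ := exists_ne_vertices_of_mem_nonUniqueCosts hA
    exact Set.mem_biUnion (x := (V, W)) ⟨⟨hV, hW⟩, hVW⟩ h0
  refine MeasureTheory.measure_mono_null hsub ?_
  rw [MeasureTheory.measure_biUnion_null_iff ((hfin.prod hfin).subset
    Set.inter_subset_left).countable]
  exact fun p hp => volume_cost_eq_zero (sub_ne_zero.2 hp.2)

/-- For a generic cost the optimal face is a single vertex. -/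
lemma exists_optimalFace_eq_singleton (h : (transportPolytope r c).Nonempty)
    (hC : C ∉ nonUniqueCosts r c) : ∃ V ∈ vertices r c, optimalFace C r c = {V} := by
  obtain ⟨V, hV⟩ := nonempty_optimalVertices (C := C) h
  have hVF : V ∈ optimalFace C r c := subset_convexHull ℝ _ hV
  refine ⟨V, hV.1, Set.eq_singleton_iff_unique_mem.2 ⟨hVF, fun P hP => ?_⟩⟩
  by_contra hne
  exact hC ⟨P, V, isOptimalPlan_iff.2 hP, isOptimalPlan_iff.2 hVF, hne⟩

lemma sparsity_le_two_div {V : Matrix (Fin n) (Fin n) ℝ} (hV : V ∈ vertices r c) :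
    sparsity V ≤ 2 / (n : ℝ) := by
  rcases Nat.eq_zero_or_pos n with rfl | hn
  · simp [sparsity]
  have h : (l0Norm V : ℝ) ≤ 2 * n := by exact_mod_cast l0Norm_le_of_mem_vertices hV
  have hn' : (0 : ℝ) < n := by exact_mod_cast hn
  rw [sparsity, Fintype.card_fin, div_le_div_iff₀ (by positivity) hn']
  nlinarith

/-- The vertices of the Birkhoff polytope are the rescaled permutation matrices. -/
lemma exists_perm_of_mem_vertices (hn : n ≠ 0) (hr : ∀ i, r i = 1 / (n : ℝ))
    (hc : ∀ j, c j = 1 / (n : ℝ)) {V : Matrix (Fin n) (Fin n) ℝ} (hV : V ∈ vertices r c) :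
    ∃ σ : Equiv.Perm (Fin n), (n : ℝ) • V = σ.permMatrix ℝ := by
  have hn' : (n : ℝ) ≠ 0 := by exact_mod_cast hn
  have hn0 : (0 : ℝ) ≤ n := Nat.cast_nonneg n
  -- Scaling by `n` identifies the polytope with the doubly stochastic matrices, so it carries
  -- extreme points to extreme points and Birkhoff's theorem applies.
  have hmem : ∀ M : Matrix (Fin n) (Fin n) ℝ, M ∈ transportPolytope r c ↔
      (n : ℝ) • M ∈ (doublyStochastic ℝ (Fin n) : Set (Matrix (Fin n) (Fin n) ℝ)) := by
    intro M
    rw [SetLike.mem_coe, mem_doublyStochastic_iff_sum, mem_transportPolytope]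
    have hpos : (0 : ℝ) < n := lt_of_le_of_ne hn0 hn'.symm
    simp only [hr, hc, Matrix.smul_apply, smul_eq_mul, ← Finset.sum_mul,
      mul_nonneg_iff_of_pos_right hpos, eq_div_iff hn', mul_comm (n : ℝ)]
    tauto
  have hext : (n : ℝ) • V ∈
      (doublyStochastic ℝ (Fin n) : Set (Matrix (Fin n) (Fin n) ℝ)).extremePoints ℝ := by
    refine mem_extremePoints.2 ⟨(hmem V).1 hV.1, fun A hA B hB hAB => ?_⟩
    have hinv : ∀ M : Matrix (Fin n) (Fin n) ℝ, (n : ℝ) • (n : ℝ)⁻¹ • M = M :=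
      fun M => smul_inv_smul₀ hn' M
    have h := (mem_extremePoints.1 hV).2 ((n : ℝ)⁻¹ • A) ((hmem _).2 (by rwa [hinv]))
      ((n : ℝ)⁻¹ • B) ((hmem _).2 (by rwa [hinv])) (by
        obtain ⟨a, b, ha, hb, hab, h⟩ := hAB
        refine ⟨a, b, ha, hb, hab, ?_⟩
        rw [smul_comm a, smul_comm b, ← smul_add, h, inv_smul_smul₀ hn'])
    exact ⟨by rw [← h.1, hinv], by rw [← h.2, hinv]⟩
  rw [extremePoints_doublyStochastic] at hext
  obtain ⟨σ, hσ⟩ := hext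
  exact ⟨σ, hσ.symm⟩

lemma l0Norm_permMatrix (σ : Equiv.Perm (Fin n)) : l0Norm (σ.permMatrix ℝ) = n := by
  have h : {p : Fin n × Fin n | σ.permMatrix ℝ p.1 p.2 ≠ 0} = Set.range fun i => (i, σ i) := by
    ext ⟨i, j⟩
    simp [Equiv.Perm.permMatrix, PEquiv.toMatrix_apply]
  have h2 : l0Norm (σ.permMatrix ℝ) = {p : Fin n × Fin n | σ.permMatrix ℝ p.1 p.2 ≠ 0}.ncard := by
    rw [l0Norm, ← Set.ncard_coe_finset, Finset.coe_filter]
    simp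
  have hinj : Function.Injective fun i => (i, σ i) := fun i j hij => (Prod.ext_iff.1 hij).1
  rw [h2, h, ← Set.image_univ, Set.ncard_image_of_injective _ hinj, Set.ncard_univ, Nat.card_fin]

lemma sparsity_eq_one_div (hn : n ≠ 0) (hr : ∀ i, r i = 1 / (n : ℝ))
    (hc : ∀ j, c j = 1 / (n : ℝ)) {V : Matrix (Fin n) (Fin n) ℝ} (hV : V ∈ vertices r c) :
    sparsity V = 1 / (n : ℝ) := by
  have hn' : (n : ℝ) ≠ 0 := by exact_mod_cast hn
  obtain ⟨σ, hσ⟩ := exists_perm_of_mem_vertices hn hr hc hV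
  have h : l0Norm V = n := by
    have h1 := l0Norm_permMatrix σ
    rw [← hσ] at h1
    simpa [l0Norm, hn] using h1
  rw [sparsity, h, Fintype.card_fin]
  field_simp

end Generic

end EntropicOT

/-! ### Assembly of the main theorem. -/

theorem mainTheorem1 {n : ℕ} (r c : Fin n → ℝ)
    (hr : ∀ i, 0 ≤ r i) (hc : ∀ j, 0 ≤ c j)
    (hr1 : ∑ i, |r i| = 1) (hc1 : ∑ j, |c j| = 1) :
    (∀ C : Matrix (Fin n) (Fin n) ℝ, (∀ i, 0 < r i) → (∀ j, 0 < c j) →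
      (EntropicOT.vertices r c \ EntropicOT.optimalVertices C r c).Nonempty →
      ∃ t₁ : ℕ, ∀ η : ℝ, (1 + 2 * Real.log n) / EntropicOT.vertexGap C r c < η →
        ∃ q : ℝ, 0 < q ∧ ∀ (x₀ y₀ : Fin n → ℝ) (t : ℕ), t₁ < t →
          EntropicOT.faceDist C r c (EntropicOT.sinkhornPlan η C r c x₀ y₀ t)
            ≤ EntropicOT.errorBound η C r c q t ∧
          EntropicOT.IsApproxSparse (EntropicOT.sinkhornPlan η C r c x₀ y₀ t)
            (EntropicOT.faceSparsity C r c) (EntropicOT.errorBound η C r c q t) ∧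
          EntropicOT.IsApproxSparse (η⁻¹ • EntropicOT.sinkhornHessian η C r c x₀ y₀ t)
            (EntropicOT.faceSparsity C r c / 2 + 1 / (2 * (n : ℝ)))
            (2 * EntropicOT.errorBound η C r c q t)) ∧
    MeasureTheory.volume
      {A : Fin n → Fin n → ℝ | Matrix.of A ∈ EntropicOT.nonUniqueCosts r c} = 0 ∧
    (∀ C : Matrix (Fin n) (Fin n) ℝ, C ∉ EntropicOT.nonUniqueCosts r c →
      (∃! P, EntropicOT.IsOptimalPlan C r c P) ∧
      EntropicOT.faceSparsity C r c ≤ 2 / (n : ℝ) ∧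
      ((∀ i, r i = 1 / (n : ℝ)) → (∀ j, c j = 1 / (n : ℝ)) →
        EntropicOT.faceSparsity C r c = 1 / (n : ℝ))) := by
  simp only [abs_of_nonneg (hr _)] at hr1
  simp only [abs_of_nonneg (hc _)] at hc1
  have hn : n ≠ 0 := by rintro rfl; simp at hr1
  -- The choice `t₁ = 0` suffices, as the rate holds from the first iteration on.
  refine ⟨fun C hr0 hc0 hne => ⟨0, fun η hη => ?_⟩, EntropicOT.volume_nonUniqueCosts r c,
    fun C hC => ?_⟩
  · have hη0 : 0 < η := lt_of_le_of_lt
      (div_nonneg (by linarith [Real.log_natCast_nonneg n]) (EntropicOT.vertexGap_pos hne).le) hη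
    obtain ⟨x, y, hP⟩ :=
      EntropicOT.exists_plan_mem_transportPolytope hη0 hr0 hc0 hr1 hc1 C
    obtain ⟨A, hA, hAP⟩ := EntropicOT.exists_mem_optimalFace_l1Norm_le hr1 hne hη0 hP
    refine ⟨4 * (4 * (η * (2 * EntropicOT.oscBound η C r)) ^ 2 + 1), by positivity,
      fun x₀ y₀ t ht => ?_⟩
    have hconv := EntropicOT.l1Norm_plan_sub_sinkhornPlan_le hη0 hr0 hc0 hr1 hc1 hP x₀ y₀ ht
    have hdist := EntropicOT.l1Norm_add_le (A - EntropicOT.plan η C x y)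
      (EntropicOT.plan η C x y - EntropicOT.sinkhornPlan η C r c x₀ y₀ t)
    rw [sub_add_sub_cancel] at hdist
    replace hdist := hdist.trans (add_le_add hAP hconv)
    have hdist' := hdist
    rw [EntropicOT.l1Norm_sub_comm] at hdist'
    exact ⟨(EntropicOT.faceDist_le hA).trans hdist,
      ⟨A, EntropicOT.sparsity_le_faceSparsity hA, hdist'⟩,
      EntropicOT.isApproxSparse_hessian hη0.ne' hn (EntropicOT.sparsity_le_faceSparsity hA) hdist'⟩
  · obtain ⟨V, hV, hF⟩ := EntropicOT.exists_optimalFace_eq_singleton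
      ⟨_, EntropicOT.vecMulVec_mem_transportPolytope hr hc hr1 hc1⟩ hC
    have hs : EntropicOT.faceSparsity C r c = EntropicOT.sparsity V := by
      rw [EntropicOT.faceSparsity, hF, Set.image_singleton, csSup_singleton]
    rw [hs]
    refine ⟨⟨V, ?_, fun P hP => ?_⟩, EntropicOT.sparsity_le_two_div hV,
      fun hr' hc' => EntropicOT.sparsity_eq_one_div hn hr' hc' hV⟩
    · simp only [EntropicOT.isOptimalPlan_iff, hF, Set.mem_singleton_iff]
    · simpa only [EntropicOT.isOptimalPlan_iff, hF, Set.mem_singleton_iff] using hP
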